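/- Let $K$ be an algebraically closed field whose multiplicative group contains an element that is not a root of unity. **The algebras.** Let $\mathcal Q$ be a finite quiver in which each vertex is either the source of two arrows and the target of two arrows (valency two) or the source of one arrow and the target of one arrow (valency one). Let $\sigma$ be a permutation of the arrows such that $\sigma(\alpha)$ starts where $\alpha$ ends, and let $\mu$ be a function from arrows to positive integers that is constant on the cycles of $\sigma$. For an arrow $\alpha$ with $\sigma$-cycle $(\alpha_1=\alpha,\alpha_2,\dots,\alpha_r)$ put $Z_\alpha=(\alpha_1\alpha_2\cdots\alpha_r)^{\mu(\alpha)}$ (paths are written from left to right), and assume that every $Z_\alpha$ has length at least $2$. For a family $\mathbf q=(q_\alpha)$ of non-zero scalars indexed by the arrows, $\Lambda_{\mathbf q}$ is the quotient of the path algebra $K\mathcal Q$ by the relations - $\alpha\beta=0$ whenever $\alpha$ ends where $\beta$ starts and $\beta\ne\sigma(\alpha)$; - $q_\alpha Z_\alpha+q_\beta Z_\beta=0$ whenever $\alpha\neq\beta$ are the two arrows starting at a vertex of valency two (the socle relation at this vertex); - $Z_\alpha\alpha=0$ whenever $\alpha$ is the only arrow starting at a vertex of valency one. (When $\mathcal Q$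 is connected, these are the weakly symmetric special biserial algebras; the scalars $q_\alpha$ at vertices of valency two are the socle parameters, and the others play no role.) **Band words.** A band word $W$ consists of an integer $m\ge 0$ and paths $a_t\colon e_t\to f_t$ and $b_t\colon e_{t+1}\to f_t$ (with $t\in\mathbb Z/(m+1)$) of positive length, where $e_t,f_t$ are vertices of valency two, such that each $a_t$ and each $b_t$ is a proper initial subpath of $Z_\alpha$ with $\alpha$ its first arrow, $a_{t+1}$ and $b_t$ have different first arrows, and $a_t$ and $b_t$ have different last arrows. Moreover $(a_t,b_t)_{t}$ is not a concatenation of copies of a shorter such sequence. Write $Z_\alpha=a_tA_t$ for the first arrow $\alpha$ of $a_t$, and $Z_\beta=b_tB_t$ for the first arrow $\beta$ of $b_t$, and write the socle relations at $f_t$ and at $e_t$ as $$p_t\,A_ta_t+q_t\,B_tb_t=0,\qquad p_t'\,a_tA_t+q_t'\,b_{t-1}B_{t-1}=0 .$$ The parameter of $W$ is $v=\prod_{t=0}^m (q_t/p_t)\prod_{t=0}^m(p'_t/q'_t)$. **Band modules.** For $0\ne\lambda\in K$, the band module $M(\lambda)$ of $W$ is the right $\Lambda_{\mathbf q}$-module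 that has one basis vector for each point of the closed walk $e_0\xrightarrow{a_0}f_0\xleftarrow{b_0}e_1\xrightarrow{a_1}f_1\leftarrow\cdots\xleftarrow{b_m}e_{m+1}=e_0$ (so its dimension is the sum of the lengths of all $a_t$ and $b_t$), where each step of the walk labelled by an arrow $\alpha$ means that $\alpha$ maps the basis vector at the start of the step to the one at its end, multiplied by $\lambda$ if the step is the first arrow of $a_0$; all other actions of arrows on basis vectors are zero. **Criminals.** A finite-dimensional non-projective module $M$ has complexity one if the dimensions of the terms of its minimal projective resolution have a common upper bound, and is periodic if $\Omega^d(M)\cong M$ for some $d\ge1$. A criminal is a finite-dimensional module that has complexity one and is not periodic. **Lemma 4.4.** Suppose that $W$ is a band word for which $e_0,\dots,e_m$ are pairwise distinct, $f_0,\dots,f_m$ are pairwise distinct, and $\{e_0,\dots,e_m\}\ne\{f_0,\dots,f_m\}$. Then there is a choice of $\mathbf q$ such that the parameter $v$ of $W$ is not a root of unity and, for every non-zero $\lambda\in K$, the band module $M(\lambda)$ of $W$ is a criminal for $\Lambda_{\mathbf q}$. In particular, $\Lambda_{\mathbf q}$ has criminals. -/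

import Mathlib

universe u v w x

noncomputable section

/-! ## Minimal projective resolutions, periodic modules, criminals -/

/-- A submodule `N` of `P` is superfluous if `N + S = P` forces `S = P`. -/
def IsSuperfluous {R : Type w} [Ring R] {P : Type x} [AddCommGroup P] [Module R P]
    (N : Submodule R P) : Prop :=
  ∀ S : Submodule R P, N ⊔ S = ⊤ → S = ⊤

/-- A minimal projective resolution `⋯ → P 2 → P 1 → P 0 → M → 0`: an exact complex of projective
modules in which `P 0 → M` is a projective cover and each `P (n + 1)` is a projective cover of the
kernel of the previous map. -/
structure MinimalProjectiveResolution (R : Type w) [Ring R] (M : Type x) [AddCommGroup M]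
    [Module R M] where
  P : ℕ → Type w
  [addCommGroup : ∀ n, AddCommGroup (P n)]
  [module : ∀ n, Module R (P n)]
  /-- the augmentation `P 0 → M` -/
  aug : P 0 →ₗ[R] M
  d : ∀ n, P (n + 1) →ₗ[R] P n
  projective : ∀ n, Module.Projective R (P n)
  surjective_aug : Function.Surjective aug
  exact_aug : Function.Exact (d 0) aug
  exact_d : ∀ n, Function.Exact (d (n + 1)) (d n)
  minimal_aug : IsSuperfluous (LinearMap.ker aug)
  minimal_d : ∀ n, IsSuperfluous (LinearMap.ker (d n))

namespace MinimalProjectiveResolution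

attribute [instance] addCommGroup module

variable {R : Type w} [Ring R] {M : Type x} [AddCommGroup M] [Module R M]

/-- `X.syzygy n` is the syzygy `Ω^(n+1)(M)`, a submodule of `P n`. -/
def syzygy (X : MinimalProjectiveResolution R M) : ∀ n, Submodule R (X.P n)
  | 0 => LinearMap.ker X.aug
  | n + 1 => LinearMap.ker (X.d n)

end MinimalProjectiveResolution

/-- `M` is not projective and the `K`-dimensions of the terms of its minimal projective resolution
have a common upper bound. -/
def HasComplexityOne (K : Type u) [Field K] (R : Type w) [Ring R] [Algebra K R]
    (M : Type x) [AddCommGroup M] [Module R M] : Prop :=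
  ¬ Module.Projective R M ∧
    ∃ (X : MinimalProjectiveResolution R M) (N : ℕ),
      ∀ n, Module.rank K (RestrictScalars K R (X.P n)) ≤ N

/-- `Ω^d(M) ≅ M` for some `d ≥ 1`. -/
def IsPeriodicModule (R : Type w) [Ring R] (M : Type x) [AddCommGroup M] [Module R M] : Prop :=
  ∃ (X : MinimalProjectiveResolution R M) (n : ℕ), Nonempty (X.syzygy n ≃ₗ[R] M)

/-- A criminal: a finite-dimensional module of complexity one that is not periodic. -/
def IsCriminal (K : Type u) [Field K] (R : Type w) [Ring R] [Algebra K R]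
    (M : Type x) [AddCommGroup M] [Module R M] : Prop :=
  Module.Finite K (RestrictScalars K R M) ∧ HasComplexityOne K R M ∧ ¬ IsPeriodicModule R M

/-! ## Weakly symmetric special biserial algebras -/

/-- The combinatorial data of a family of weakly symmetric special biserial algebras.  The quiver
has vertices `V` and arrows `A`.  Each vertex is the source of two arrows and the target of two
arrows (valency two), or the source of one and the target of one (valency one).

`σ α` is the unique arrow with `α (σ α) ≠ 0`; the zero relations of length two are the other
composable pairs `α β`.  That `σ` is a permutation says exactly that for every `γ` and every two
different arrows `α`, `β` starting where `γ` ends, precisely one of `γ α`, `γ β` is a relation,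
and dually.

The closed path in a socle relation that starts with the arrow `α` is the power
`(α (σ α) (σ² α) ⋯)^(mult α)` of the cycle of `σ` through `α`.  That `mult` is constant on the
cycles of `σ` says that the rotations of these paths are again paths in socle relations. -/
structure SpecialBiserial (V A : Type v) [Fintype V] [Fintype A] where
  src : A → V
  tgt : A → V
  valency : ∀ i : V,
    (Nat.card {α : A // src α = i} = 2 ∧ Nat.card {α : A // tgt α = i} = 2) ∨
    (Nat.card {α : A // src α = i} = 1 ∧ Nat.card {α : A // tgt α = i} = 1)
  σ : Equiv.Perm A
  src_σ : ∀ α, src (σ α) = tgt α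
  mult : A → ℕ
  mult_pos : ∀ α, 0 < mult α
  mult_σ : ∀ α, mult (σ α) = mult α
  two_le : ∀ α, 2 ≤ mult α * Function.minimalPeriod σ α

namespace SpecialBiserial

variable {V A : Type v} [Fintype V] [Fintype A] (Q : SpecialBiserial V A)

/-- The length of the closed path starting with `α` in the socle relation at `src α`. -/
def len (α : A) : ℕ := Q.mult α * Function.minimalPeriod Q.σ α

variable (K : Type u) [Field K]

/-- The idempotent of the vertex `i`, as a generator. -/
def vert (i : V) : FreeAlgebra K (V ⊕ A) := FreeAlgebra.ι K (Sum.inl i)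

/-- The arrow `α`, as a generator. -/
def arr (α : A) : FreeAlgebra K (V ⊕ A) := FreeAlgebra.ι K (Sum.inr α)

/-- The closed path `α (σ α) (σ² α) ⋯` of length `len α`. -/
def cyc (α : A) : FreeAlgebra K (V ⊕ A) :=
  ((List.range (Q.len α)).map fun j => arr (V := V) K ((Q.σ ^ j) α)).prod

variable {K}

/-- The relations of the algebra.  The first five present the path algebra of the quiver (paths
are written from left to right), the others are the relations of the bound quiver.  The scalars
`p_i`, `q_i` of the socle relation `p_i C_i + q_i D_i` at a vertex `i` of valency two are the
values of `q` at the two arrows starting at `i`, with which `C_i` and `D_i` start; the values of `q`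
at the other arrows are not used. -/
inductive Rel (q : A → Kˣ) : FreeAlgebra K (V ⊕ A) → FreeAlgebra K (V ⊕ A) → Prop
  | idem (i : V) : Rel q (vert K i * vert K i) (vert K i)
  | orth (i j : V) : i ≠ j → Rel q (vert K i * vert K j) 0
  | one : Rel q (∑ i : V, vert K i) 1
  | src_mul (α : A) : Rel q (vert K (Q.src α) * arr K α) (arr K α)
  | mul_tgt (α : A) : Rel q (arr K α * vert K (Q.tgt α)) (arr K α)
  | zero (α β : A) : Q.tgt α = Q.src β → β ≠ Q.σ α → Rel q (arr K α * arr K β) 0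
  | socle_two (α β : A) : Q.src α = Q.src β → α ≠ β →
      Rel q ((q α : K) • Q.cyc K α + (q β : K) • Q.cyc K β) 0
  | socle_one (α : A) : (∀ β, Q.src β = Q.src α → β = α) → Rel q (Q.cyc K α * arr K α) 0

/-- The algebra `Λ_q`. -/
abbrev Alg (q : A → Kˣ) : Type (max u v) := RingQuot (Q.Rel q)

/-! ## Band words -/

/-- A path of positive length that is a proper initial subpath of the closed path starting with
the arrow `head` in the socle relation at its source: it is
`head (σ head) ⋯ (σ ^ (length - 1) head)`. -/
structure InitialPath where
  head : A
  length : ℕ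
  length_pos : 0 < length
  length_lt : length < Q.len head

namespace InitialPath

variable {Q}

/-- The arrows of the path, numbered from `0`. -/
def arrow (s : Q.InitialPath) (j : ℕ) : A := (Q.σ ^ j) s.head

def source (s : Q.InitialPath) : V := Q.src s.head

def last (s : Q.InitialPath) : A := s.arrow (s.length - 1)

def target (s : Q.InitialPath) : V := Q.tgt s.last

end InitialPath

/-- A band word `e 0 -a 0→ f 0 ←b 0- e 1 -a 1→ f 1 ← ⋯ f m ←b m- e (m + 1) = e 0`; indices are
taken modulo `m + 1`.  At `e (t + 1)` the paths `a (t + 1)` and `b t` are initial subpaths of the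
two different closed paths of the socle relation, and at `f t` the paths `a t` and `b t`
are final subpaths of the two different closed paths of the socle relation; in particular all
`e t` and `f t` have valency two. -/
structure BandWord where
  m : ℕ
  a : Fin (m + 1) → Q.InitialPath
  b : Fin (m + 1) → Q.InitialPath
  source_b : ∀ t, (b t).source = (a (t + 1)).source
  head_ne : ∀ t, (b t).head ≠ (a (t + 1)).head
  target_b : ∀ t, (b t).target = (a t).target
  last_ne : ∀ t, (b t).last ≠ (a t).last
  /-- The word is not a concatenation of copies of a shorter word. -/
  minimal : ∀ r : Fin (m + 1), (∀ t, a (t + r) = a t ∧ b (t + r) = b t) → r = 0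

namespace BandWord

variable {Q} (W : Q.BandWord)

def e (t : Fin (W.m + 1)) : V := (W.a t).source

def f (t : Fin (W.m + 1)) : V := (W.a t).target

/-- The coefficient `p_t` of `A_t a_t` in the socle relation at `f t`.  Here `A_t` is the path
with `a_t A_t` the closed path at `e t`, so that `A_t a_t` starts with `σ` of the last arrow of
`a_t`. -/
def pF (q : A → Kˣ) (t : Fin (W.m + 1)) : Kˣ := q (Q.σ (W.a t).last)

/-- The coefficient `q_t` of `B_t b_t` in the socle relation at `f t`. -/
def qF (q : A → Kˣ) (t : Fin (W.m + 1)) : Kˣ := q (Q.σ (W.b t).last)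

/-- The coefficient `p'_t` of `a_t A_t` in the socle relation at `e t`. -/
def pE (q : A → Kˣ) (t : Fin (W.m + 1)) : Kˣ := q (W.a t).head

/-- The coefficient `q'_t` of `b_{t-1} B_{t-1}` in the socle relation at `e t`. -/
def qE (q : A → Kˣ) (t : Fin (W.m + 1)) : Kˣ := q (W.b (t - 1)).head

/-- The parameter `v` of the band word. -/
def parameter (q : A → Kˣ) : Kˣ :=
  (∏ t, W.qF q t / W.pF q t) * ∏ t, W.pE q t / W.qE q t

/-! ## Band modules -/

/-- The index set of the basis of a band module, i.e. the points of the closed walk `W`.  The point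
`inl ⟨t, j⟩` is the start of the `j`-th arrow of `a t`; the point `inr ⟨t, j⟩` is the end of the
`j`-th arrow of `b t`.  So `e t` is `inl ⟨t, 0⟩` and `f t` is the last of the points
`inr ⟨t, j⟩`.  The same set indexes the steps of the walk: `inl ⟨t, j⟩` is the `j`-th arrow of
`a t` and `inr ⟨t, j⟩` is the `j`-th arrow of `b t`. -/
abbrev Pt : Type := (Σ t, Fin (W.a t).length) ⊕ (Σ t, Fin (W.b t).length)

/-- The vertex of the quiver at a point of the walk. -/
def vertex : W.Pt → V
  | Sum.inl ⟨t, j⟩ => Q.src ((W.a t).arrow j)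
  | Sum.inr ⟨t, j⟩ => Q.tgt ((W.b t).arrow j)

/-- The arrow of the quiver at a step of the walk. -/
def label : W.Pt → A
  | Sum.inl ⟨t, j⟩ => (W.a t).arrow j
  | Sum.inr ⟨t, j⟩ => (W.b t).arrow j

/-- The point where a step of the walk starts. -/
def start : W.Pt → W.Pt
  | Sum.inl ⟨t, j⟩ => Sum.inl ⟨t, j⟩
  | Sum.inr ⟨t, j⟩ =>
      if (j : ℕ) = 0 then Sum.inl ⟨t + 1, ⟨0, (W.a (t + 1)).length_pos⟩⟩
      else Sum.inr ⟨t, ⟨j - 1, by omega⟩⟩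

/-- The point where a step of the walk ends. -/
def finish : W.Pt → W.Pt
  | Sum.inl ⟨t, j⟩ =>
      if h : (j : ℕ) + 1 < (W.a t).length then Sum.inl ⟨t, ⟨j + 1, h⟩⟩
      else Sum.inr ⟨t, ⟨(W.b t).length - 1, Nat.sub_lt (W.b t).length_pos one_pos⟩⟩
  | Sum.inr ⟨t, j⟩ => Sum.inr ⟨t, j⟩

/-- The scalar at a step of the walk: `lam` for the first arrow of `a 0`, and `1` otherwise. -/
def weight (lam : K) : W.Pt → K
  | Sum.inl ⟨t, j⟩ => if t = 0 ∧ (j : ℕ) = 0 then lam else 1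
  | Sum.inr _ => 1

open Classical in
/-- The matrices by which vertices and arrows act on row vectors: a vertex `i` acts as the
projection onto the points at `i`, and an arrow `α` maps the basis vector at the start of each
step labelled `α` to the weight of the step times the basis vector at its end. -/
def genMatrix (lam : K) : V ⊕ A → Matrix W.Pt W.Pt K
  | Sum.inl i => Matrix.diagonal fun z => if W.vertex z = i then 1 else 0
  | Sum.inr α => Matrix.of fun y z =>
      ∑ s : W.Pt, if W.label s = α ∧ W.start s = y ∧ W.finish s = z then W.weight lam s else 0

lemma vertex_start (s : W.Pt) : W.vertex (W.start s) = Q.src (W.label s) := by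
  rcases s with ⟨t, j⟩ | ⟨t, ⟨j, hj⟩⟩
  · rfl
  · cases j with
    | zero => exact (W.source_b t).symm
    | succ n =>
      change Q.tgt ((Q.σ ^ n) (W.b t).head) = Q.src ((Q.σ ^ (n + 1)) (W.b t).head)
      rw [pow_succ', Equiv.Perm.mul_apply, Q.src_σ]

lemma vertex_finish (s : W.Pt) : W.vertex (W.finish s) = Q.tgt (W.label s) := by
  rcases s with ⟨t, ⟨j, hj⟩⟩ | ⟨t, j⟩
  · by_cases h : j + 1 < (W.a t).length
    · simp only [finish, h, dite_true, vertex, label, InitialPath.arrow]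
      rw [pow_succ', Equiv.Perm.mul_apply, Q.src_σ]
    · simp only [finish, h, dite_false, vertex, label]
      have hj' : j = (W.a t).length - 1 := by omega
      rw [hj']
      exact W.target_b t
  · rfl

/-- The number of steps from a step of the walk, inclusive, to the end of its path. -/
def remaining : W.Pt → ℕ
  | Sum.inl ⟨t, j⟩ => (W.a t).length - j
  | Sum.inr ⟨t, j⟩ => (W.b t).length - j

lemma consecutive (s s' : W.Pt) (h : W.finish s = W.start s') :
    W.label s' = Q.σ (W.label s) ∧ W.remaining s = W.remaining s' + 1 := by
  rcases s with ⟨t, ⟨j, hj⟩⟩ | ⟨t, ⟨j, hj⟩⟩ <;> rcases s' with ⟨t', ⟨j', hj'⟩⟩ | ⟨t', ⟨j', hj'⟩⟩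
  · by_cases hl : j + 1 < (W.a t).length
    · simp only [finish, hl, dite_true, start, Sum.inl.injEq, Sigma.mk.injEq] at h
      obtain ⟨rfl, h⟩ := h
      simp only [heq_eq_eq, Fin.mk.injEq] at h
      subst h
      refine ⟨?_, by simp only [remaining]; omega⟩
      simp only [label, InitialPath.arrow]
      rw [pow_succ', Equiv.Perm.mul_apply]
    · simp [finish, hl, start] at h
  · by_cases hl : j + 1 < (W.a t).length <;> cases j' <;>
      simp [finish, hl, start] at h
    · obtain ⟨rfl, h⟩ := h
      simp at h
    · obtain ⟨rfl, h⟩ := h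
      simp at h
      omega
  · simp [finish, start] at h
  · cases j' with
    | zero => simp [finish, start] at h
    | succ n =>
      simp only [finish, start, Nat.add_eq_zero_iff, one_ne_zero, and_false, if_false,
        Sum.inr.injEq, Sigma.mk.injEq] at h
      obtain ⟨rfl, h⟩ := h
      simp only [heq_eq_eq, Fin.mk.injEq, Nat.add_sub_cancel] at h
      subst h
      refine ⟨?_, by simp only [remaining]; omega⟩
      simp only [label, InitialPath.arrow]
      rw [pow_succ', Equiv.Perm.mul_apply]

lemma len_pow (α : A) (j : ℕ) : Q.len ((Q.σ ^ j) α) = Q.len α := by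
  induction j with
  | zero => rfl
  | succ n ih =>
    rw [pow_succ', Equiv.Perm.mul_apply, ← ih]
    unfold len
    rw [Q.mult_σ]
    congr 1
    refine Function.minimalPeriod_apply
      ((Function.mem_periodicPts).2 ⟨orderOf Q.σ, orderOf_pos Q.σ, ?_⟩)
    rw [Function.IsPeriodicPt, Function.IsFixedPt, ← Equiv.Perm.coe_pow, pow_orderOf_eq_one]
    rfl

lemma remaining_lt (s : W.Pt) : W.remaining s < Q.len (W.label s) := by
  rcases s with ⟨t, j⟩ | ⟨t, j⟩
  · simp only [remaining, label, InitialPath.arrow, len_pow]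
    have := (W.a t).length_lt
    omega
  · simp only [remaining, label, InitialPath.arrow, len_pow]
    have := (W.b t).length_lt
    omega

lemma exists_step (lam : K) (α : A) (y z : W.Pt) (h : W.genMatrix lam (Sum.inr α) y z ≠ 0) :
    ∃ s, W.label s = α ∧ W.start s = y ∧ W.finish s = z := by
  obtain ⟨s, -, hs⟩ := Finset.exists_ne_zero_of_sum_ne_zero h
  exact ⟨s, by_contra fun hn => hs (if_neg hn)⟩

lemma exists_of_mul_ne_zero (M N : Matrix W.Pt W.Pt K) (y z : W.Pt) (h : (M * N) y z ≠ 0) :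
    ∃ x, M y x ≠ 0 ∧ N x z ≠ 0 := by
  obtain ⟨x, -, hx⟩ := Finset.exists_ne_zero_of_sum_ne_zero h
  exact ⟨x, left_ne_zero_of_mul hx, right_ne_zero_of_mul hx⟩

lemma le_remaining (lam : K) (n : ℕ) : ∀ (α : A) (y z : W.Pt),
    (((List.range (n + 1)).map fun j => W.genMatrix lam (Sum.inr ((Q.σ ^ j) α))).prod) y z ≠ 0 →
      ∃ s, W.label s = α ∧ W.start s = y ∧ n + 1 ≤ W.remaining s := by
  induction n with
  | zero =>
    intro α y z h
    obtain ⟨s, h1, h2, -⟩ := W.exists_step lam α y z (by simpa using h)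
    refine ⟨s, h1, h2, ?_⟩
    rcases s with ⟨t, j⟩ | ⟨t, j⟩ <;> simp only [remaining] <;> omega
  | succ n ih =>
    intro α y z h
    rw [List.range_succ_eq_map, List.map_cons, List.prod_cons, List.map_map] at h
    obtain ⟨x, hx, hz⟩ := W.exists_of_mul_ne_zero _ _ y z h
    obtain ⟨s, h1, h2, h3⟩ := W.exists_step lam α y x (by simpa using hx)
    obtain ⟨s', -, h2', h3'⟩ := ih (Q.σ α) x z (by
      simpa only [Function.comp_def, pow_succ, Equiv.Perm.mul_apply] using hz)
    exact ⟨s, h1, h2, by have := (W.consecutive s s' (h3.trans h2'.symm)).2; omega⟩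

lemma lift_cyc (lam : K) (α : A) :
    FreeAlgebra.lift K (W.genMatrix lam) (Q.cyc K α) = 0 := by
  have h : FreeAlgebra.lift K (W.genMatrix lam) (Q.cyc K α) =
      ((List.range (Q.len α)).map fun j => W.genMatrix lam (Sum.inr ((Q.σ ^ j) α))).prod := by
    rw [cyc, map_list_prod, List.map_map]
    simp only [Function.comp_def, arr, FreeAlgebra.lift_ι_apply]
  rw [h]
  ext y z
  by_contra hn
  have h2 : 2 ≤ Q.len α := Q.two_le α
  obtain ⟨n, hn'⟩ : ∃ n, Q.len α = n + 1 := ⟨Q.len α - 1, by omega⟩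
  rw [hn'] at hn
  obtain ⟨s, h1, -, h3⟩ := W.le_remaining lam n α y z hn
  have := W.remaining_lt s
  rw [h1] at this
  omega

lemma lift_rel (lam : K) (q : A → Kˣ) ⦃x y : FreeAlgebra K (V ⊕ A)⦄ (h : Q.Rel q x y) :
    FreeAlgebra.lift K (W.genMatrix lam) x = FreeAlgebra.lift K (W.genMatrix lam) y := by
  classical
  cases h with
  | idem i => simp [vert, genMatrix]
  | orth i j hij =>
    simp only [vert, map_mul, FreeAlgebra.lift_ι_apply, genMatrix, Matrix.diagonal_mul_diagonal,
      map_zero]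
    ext y z
    by_cases hyz : y = z
    · subst hyz
      simp only [Matrix.diagonal_apply_eq, Matrix.zero_apply]
      by_cases h1 : W.vertex y = i
      · simp [h1, hij]
      · simp [h1]
    · simp [hyz]
  | one =>
    simp only [vert, map_sum, FreeAlgebra.lift_ι_apply, genMatrix, map_one]
    ext y z
    rw [Matrix.sum_apply]
    by_cases hyz : y = z
    · subst hyz
      simp
    · simp [hyz]
  | src_mul α =>
    simp only [vert, arr, map_mul, FreeAlgebra.lift_ι_apply]
    ext y z
    simp only [genMatrix, Matrix.diagonal_mul, Matrix.of_apply, Finset.mul_sum]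
    refine Finset.sum_congr rfl fun s _ => ?_
    split_ifs with h1 h2 h2
    · simp
    · simp
    · exact absurd (by rw [← h2.2.1, W.vertex_start, h2.1]) h1
    · simp
  | mul_tgt α =>
    simp only [vert, arr, map_mul, FreeAlgebra.lift_ι_apply]
    ext y z
    simp only [genMatrix, Matrix.mul_diagonal, Matrix.of_apply, Finset.sum_mul]
    refine Finset.sum_congr rfl fun s _ => ?_
    split_ifs with h1 h2 h2
    · simp
    · exact absurd (by rw [← h1.2.2, W.vertex_finish, h1.1]) h2
    · simp
    · simp
  | zero α β _ hσ =>
    simp only [arr, map_mul, FreeAlgebra.lift_ι_apply, map_zero]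
    ext y z
    by_contra hn
    obtain ⟨x, h1, h2⟩ := W.exists_of_mul_ne_zero _ _ y z hn
    obtain ⟨s, hs1, -, hs3⟩ := W.exists_step lam α y x h1
    obtain ⟨s', hs1', hs2', -⟩ := W.exists_step lam β x z h2
    exact hσ (by rw [← hs1, ← hs1', (W.consecutive s s' (hs3.trans hs2'.symm)).1])
  | socle_two α β _ _ => simp [lift_cyc]
  | socle_one α _ => simp [lift_cyc]

/-- The matrix representation, on row vectors, that defines the band module. -/
def rep (q : A → Kˣ) (lam : Kˣ) : Q.Alg q →ₐ[K] Matrix W.Pt W.Pt K :=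
  RingQuot.liftAlgHom K ⟨FreeAlgebra.lift K (W.genMatrix (lam : K)), W.lift_rel (lam : K) q⟩

/-- The band module `M(lam)` (with one-dimensional spaces `V = K`), as a right module over
`Λ_q`. -/
def BandModule (_q : A → Kˣ) (_lam : Kˣ) : Type u := W.Pt → K

instance (q : A → Kˣ) (lam : Kˣ) : AddCommGroup (W.BandModule q lam) :=
  inferInstanceAs (AddCommGroup (W.Pt → K))

instance (q : A → Kˣ) (lam : Kˣ) : Module (Q.Alg q)ᵐᵒᵖ (W.BandModule q lam) where
  smul x y := Matrix.vecMul (y : W.Pt → K) (W.rep q lam x.unop)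
  one_smul y :=
    (congrArg (Matrix.vecMul (y : W.Pt → K)) (map_one (W.rep q lam))).trans (Matrix.vecMul_one _)
  mul_smul x x' y :=
    (congrArg (Matrix.vecMul (y : W.Pt → K)) (map_mul (W.rep q lam) x'.unop x.unop)).trans
      (Matrix.vecMul_vecMul _ _ _).symm
  smul_zero _ := Matrix.zero_vecMul _
  smul_add _ _ _ := Matrix.add_vecMul _ _ _
  add_smul x x' y :=
    (congrArg (Matrix.vecMul (y : W.Pt → K)) (map_add (W.rep q lam) x.unop x'.unop)).trans
      (Matrix.vecMul_add _ _ _)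
  zero_smul y :=
    (congrArg (Matrix.vecMul (y : W.Pt → K)) (map_zero (W.rep q lam))).trans (Matrix.vecMul_zero _)

end BandWord
end SpecialBiserial
end

-- The band module `M(λ)` has one top element at each `e_t` and one socle element at each `f_t`. Its
-- projective cover is the direct sum of the projectives at the `e_t`; each is a diamond whose two
-- arms are the closed paths starting at `e_t`, glued in the socle by the socle relation. For every
-- `t` the kernel contains the difference of the ends of `a_t` and `b_t`. From this element the
-- complements `A_t` and `B_t` lead on to the socles of the diamonds, and these differences generate
-- the kernel. Hence the syzygy is again a band module: the complements are its paths, the vertices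
-- `e` and `f` change roles, and the socle relations prescribe its scalars (`exists_shortExact`).
--
-- Complementing twice gives back the old paths, while the product of the scalars is multiplied by
-- `v` (`iter_even`). All terms of the resolution have the same dimension, because lengths of closed
-- paths are constant on cycles of `σ`, so the complexity is one.
--
-- Two invariants exclude periodicity. An isomorphism preserves the vertices of tops (`exists_top`),
-- and some `e_t` is not among the `f_t`, so no odd syzygy is isomorphic to `M(λ)`. As the `e_t` are
-- distinct, the product of the scalars is an isomorphism invariant (`prod_eq_of_equiv`), so an
-- isomorphism with the syzygy of order `2k` would give `v ^ k = 1`. Syzygies are compared across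
-- arbitrary minimal resolutions by uniqueness of projective covers (`nonempty_syzygy_equiv`).
--
-- For the choice of `q`, one value is set to an element of infinite order, at the head of a path
-- `a_t` whose source is not among the `f_t`; all other values are `1`, and then `v` is that element
-- (`exists_parameter`).
--
-- Band modules and their projective covers are both instances of `Zigzag`, and the homomorphisms
-- between them come from the universal property `IsZigzag.exists_hom`.

universe y

set_option linter.unusedSectionVars false

noncomputable section

/-! ### Paths along `σ`, and zigzags with their matrices -/

namespace SpecialBiserial

variable {V A : Type v} [Fintype V] [Fintype A] (Q : SpecialBiserial V A)

lemma pow_len_apply (α : A) : (Q.σ ^ Q.len α) α = α := by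
  rw [← Equiv.Perm.iterate_eq_pow]
  exact (Function.isPeriodicPt_minimalPeriod Q.σ α).const_mul (Q.mult α)

lemma src_pow_succ (α : A) (j : ℕ) : Q.src ((Q.σ ^ (j + 1)) α) = Q.tgt ((Q.σ ^ j) α) := by
  rw [pow_succ', Equiv.Perm.mul_apply, Q.src_σ]

lemma pow_succ_apply (α : A) (j : ℕ) : (Q.σ ^ (j + 1)) α = Q.σ ((Q.σ ^ j) α) := by
  rw [pow_succ', Equiv.Perm.mul_apply]

/-- Two distinct arrows with the same source are all the arrows with that source. -/
lemma eq_or_eq_of_src_eq {α β γ : A} (hαβ : α ≠ β) (h : Q.src β = Q.src α)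
    (hγ : Q.src γ = Q.src α) : γ = α ∨ γ = β := by
  classical
  by_contra hn
  push Not at hn
  have hc : Nat.card {δ : A // Q.src δ = Q.src α} ≤ 2 := by
    rcases Q.valency (Q.src α) with h | h <;> omega
  have h3 : ({α, β, γ} : Finset A).card = 3 := by
    rw [Finset.card_eq_three]
    exact ⟨α, β, γ, hαβ, hn.1.symm, hn.2.symm, rfl⟩
  have hle : ({α, β, γ} : Finset A).card ≤ Nat.card {δ : A // Q.src δ = Q.src α} := by
    rw [Nat.card_eq_fintype_card, Fintype.card_subtype]
    refine Finset.card_le_card fun δ hδ => ?_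
    simp only [Finset.mem_insert, Finset.mem_singleton] at hδ
    rcases hδ with rfl | rfl | rfl <;> simp [h, hγ]
  omega

variable (K : Type u) [Field K]

/-- The path `α (σ α) ⋯ (σ ^ (n - 1) α)`, in the free algebra. -/
def run (α : A) (n : ℕ) : FreeAlgebra K (V ⊕ A) :=
  ((List.range n).map fun j => arr (V := V) K ((Q.σ ^ j) α)).prod

lemma run_zero (α : A) : Q.run K α 0 = 1 := rfl

lemma run_succ (α : A) (n : ℕ) :
    Q.run K α (n + 1) = Q.run K α n * arr K ((Q.σ ^ n) α) := by
  simp [run, List.range_succ]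

lemma run_succ' (α : A) (n : ℕ) :
    Q.run K α (n + 1) = arr K α * Q.run K (Q.σ α) n := by
  simp [run, List.range_succ_eq_map, Function.comp_def, pow_succ]

lemma cyc_eq_run (α : A) : Q.cyc K α = Q.run K α (Q.len α) := rfl

/-- A system of paths `α t (σ (α t)) ⋯` of length `la t` and `β s (σ (β s)) ⋯` of length `lb s`
in which the path of `β s` starts together with the path of `α (nx s)`, and the path of `α t` ends
together with the path of `β (τ t)`.  The `j`-th arrows are decorated with scalars. -/
structure Zigzag (ι : Type) where
  α : ι → A
  β : ι → A
  la : ι → ℕ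
  lb : ι → ℕ
  la_pos : ∀ t, 0 < la t
  lb_pos : ∀ s, 0 < lb s
  nx : Equiv.Perm ι
  τ : Equiv.Perm ι
  src_head : ∀ s, Q.src (β s) = Q.src (α (nx s))
  head_ne : ∀ s, β s ≠ α (nx s)
  src_end : ∀ t, Q.src ((Q.σ ^ lb (τ t)) (β (τ t))) = Q.src ((Q.σ ^ la t) (α t))
  end_ne : ∀ t, (Q.σ ^ lb (τ t)) (β (τ t)) ≠ (Q.σ ^ la t) (α t)
  wa : ι → ℕ → Kˣ
  wb : ι → ℕ → Kˣ

namespace Zigzag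

variable {Q K} {ι : Type} (Z : Zigzag Q K ι)

/-- The points of the zigzag, which also index its steps: `inl ⟨t, j⟩` is the start of the `j`-th
arrow of the path of `α t`, and `inr ⟨s, j⟩` is the end of the `j`-th arrow of the path of `β s`. -/
abbrev Pt : Type := (Σ t, Fin (Z.la t)) ⊕ (Σ s, Fin (Z.lb s))

def vertex : Z.Pt → V
  | Sum.inl ⟨t, j⟩ => Q.src ((Q.σ ^ (j : ℕ)) (Z.α t))
  | Sum.inr ⟨s, j⟩ => Q.tgt ((Q.σ ^ (j : ℕ)) (Z.β s))

def label : Z.Pt → A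
  | Sum.inl ⟨t, j⟩ => (Q.σ ^ (j : ℕ)) (Z.α t)
  | Sum.inr ⟨s, j⟩ => (Q.σ ^ (j : ℕ)) (Z.β s)

def start : Z.Pt → Z.Pt
  | Sum.inl ⟨t, j⟩ => Sum.inl ⟨t, j⟩
  | Sum.inr ⟨s, j⟩ =>
      if (j : ℕ) = 0 then Sum.inl ⟨Z.nx s, ⟨0, Z.la_pos _⟩⟩
      else Sum.inr ⟨s, ⟨j - 1, by omega⟩⟩

def finish : Z.Pt → Z.Pt
  | Sum.inl ⟨t, j⟩ =>
      if h : (j : ℕ) + 1 < Z.la t then Sum.inl ⟨t, ⟨j + 1, h⟩⟩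
      else Sum.inr ⟨Z.τ t, ⟨Z.lb (Z.τ t) - 1, Nat.sub_lt (Z.lb_pos _) one_pos⟩⟩
  | Sum.inr ⟨s, j⟩ => Sum.inr ⟨s, j⟩

def weight : Z.Pt → K
  | Sum.inl ⟨t, j⟩ => Z.wa t j
  | Sum.inr ⟨s, j⟩ => Z.wb s j

lemma weight_ne_zero (s : Z.Pt) : Z.weight s ≠ 0 := by
  rcases s with ⟨t, j⟩ | ⟨t, j⟩ <;> exact Units.ne_zero _

lemma vertex_start (s : Z.Pt) : Z.vertex (Z.start s) = Q.src (Z.label s) := by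
  rcases s with ⟨t, j⟩ | ⟨t, ⟨j, hj⟩⟩
  · rfl
  · cases j with
    | zero => exact (Z.src_head t).symm
    | succ n => exact (Q.src_pow_succ _ _).symm

lemma last_ne (t : ι) : (Q.σ ^ (Z.lb (Z.τ t) - 1)) (Z.β (Z.τ t)) ≠ (Q.σ ^ (Z.la t - 1)) (Z.α t) := by
  have h := Z.end_ne t
  have h1 := Z.la_pos t
  have h2 := Z.lb_pos (Z.τ t)
  obtain ⟨m, hm⟩ : ∃ m, Z.la t = m + 1 := ⟨Z.la t - 1, by omega⟩
  obtain ⟨n, hn⟩ : ∃ n, Z.lb (Z.τ t) = n + 1 := ⟨Z.lb (Z.τ t) - 1, by omega⟩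
  rw [hm, hn, Q.pow_succ_apply, Q.pow_succ_apply] at h
  rw [hm, hn]
  exact fun h' => h (congrArg _ h')

lemma tgt_last (t : ι) : Q.tgt ((Q.σ ^ (Z.lb (Z.τ t) - 1)) (Z.β (Z.τ t))) =
    Q.tgt ((Q.σ ^ (Z.la t - 1)) (Z.α t)) := by
  have h := Z.src_end t
  have h1 := Z.la_pos t
  have h2 := Z.lb_pos (Z.τ t)
  rw [← Q.src_pow_succ, ← Q.src_pow_succ, Nat.sub_add_cancel h1, Nat.sub_add_cancel h2, h]

lemma vertex_finish (s : Z.Pt) : Z.vertex (Z.finish s) = Q.tgt (Z.label s) := by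
  rcases s with ⟨t, ⟨j, hj⟩⟩ | ⟨t, j⟩
  · by_cases h : j + 1 < Z.la t
    · simp only [finish, h, dite_true, vertex, label]
      rw [Q.src_pow_succ]
    · simp only [finish, h, dite_false, vertex, label]
      have hj' : j = Z.la t - 1 := by omega
      rw [hj']
      exact Z.tgt_last t
  · rfl

lemma label_of_finish_eq_start (s s' : Z.Pt) (h : Z.finish s = Z.start s') :
    Z.label s' = Q.σ (Z.label s) := by
  rcases s with ⟨t, ⟨j, hj⟩⟩ | ⟨t, ⟨j, hj⟩⟩ <;> rcases s' with ⟨t', ⟨j', hj'⟩⟩ | ⟨t', ⟨j', hj'⟩⟩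
  · by_cases hl : j + 1 < Z.la t
    · simp only [finish, hl, dite_true, start, Sum.inl.injEq, Sigma.mk.injEq] at h
      obtain ⟨rfl, h⟩ := h
      simp only [heq_eq_eq, Fin.mk.injEq] at h
      subst h
      simp only [label]
      rw [Q.pow_succ_apply]
    · simp [finish, hl, start] at h
  · by_cases hl : j + 1 < Z.la t <;> cases j' <;>
      simp [finish, hl, start] at h
    · obtain ⟨rfl, h⟩ := h
      simp at h
    · obtain ⟨rfl, h⟩ := h
      simp at h
      omega
  · simp [finish, start] at h
  · cases j' with
    | zero => simp [finish, start] at h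
    | succ n =>
      simp only [finish, start, Nat.add_eq_zero_iff, one_ne_zero, and_false, if_false,
        Sum.inr.injEq, Sigma.mk.injEq] at h
      obtain ⟨rfl, h⟩ := h
      simp only [heq_eq_eq, Fin.mk.injEq, Nat.add_sub_cancel] at h
      subst h
      simp only [label]
      rw [Q.pow_succ_apply]

/-- Two steps leave a point only at a top, where `head_ne` separates their labels. With the dual
statement for ends, each arrow acts by a matrix with at most one non-zero entry in every row and
column. -/
lemma start_label_injective (s s' : Z.Pt) (h : Z.start s = Z.start s')
    (hl : Z.label s = Z.label s') : s = s' := by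
  rcases s with ⟨t, ⟨j, hj⟩⟩ | ⟨t, ⟨j, hj⟩⟩ <;> rcases s' with ⟨t', ⟨j', hj'⟩⟩ | ⟨t', ⟨j', hj'⟩⟩
  · exact h
  · cases j' with
    | zero =>
      simp only [start, if_true, Sum.inl.injEq, Sigma.mk.injEq] at h
      obtain ⟨rfl, h⟩ := h
      simp only [heq_eq_eq, Fin.mk.injEq] at h
      subst h
      exact absurd hl.symm (Z.head_ne t')
    | succ n => simp [start] at h
  · cases j with
    | zero =>
      simp only [start, if_true, Sum.inl.injEq, Sigma.mk.injEq] at h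
      obtain ⟨rfl, h⟩ := h
      simp only [heq_eq_eq, Fin.mk.injEq] at h
      subst h
      exact absurd hl (Z.head_ne t)
    | succ n => simp [start] at h
  · cases j <;> cases j' <;> simp [start] at h
    · obtain ⟨rfl, -⟩ := h
      rfl
    · obtain ⟨rfl, h⟩ := h
      simp at h
      subst h
      rfl

/-- Two steps meet only at the end of their paths, where the last arrows differ by `last_ne`. -/
lemma finish_label_injective (s s' : Z.Pt) (h : Z.finish s = Z.finish s')
    (hl : Z.label s = Z.label s') : s = s' := by
  rcases s with ⟨t, ⟨j, hj⟩⟩ | ⟨t, ⟨j, hj⟩⟩ <;> rcases s' with ⟨t', ⟨j', hj'⟩⟩ | ⟨t', ⟨j', hj'⟩⟩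
  · by_cases h1 : j + 1 < Z.la t <;> by_cases h2 : j' + 1 < Z.la t' <;>
      simp [finish, h1, h2] at h
    · obtain ⟨rfl, h⟩ := h
      simp at h
      subst h
      rfl
    · obtain ⟨h, -⟩ := h
      subst h
      obtain rfl : j = j' := by omega
      rfl
  · by_cases h1 : j + 1 < Z.la t <;> simp [finish, h1] at h
    obtain ⟨rfl, h⟩ := h
    simp at h
    subst h
    obtain rfl : j = Z.la t - 1 := by omega
    exact absurd hl.symm (Z.last_ne t)
  · by_cases h1 : j' + 1 < Z.la t' <;> simp [finish, h1] at h
    obtain ⟨rfl, h⟩ := h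
    simp at h
    subst h
    obtain rfl : j' = Z.la t' - 1 := by omega
    exact absurd hl (Z.last_ne t')
  · exact h

lemma finish_ne_top (s : Z.Pt) (t : ι) : Z.finish s ≠ Sum.inl ⟨t, ⟨0, Z.la_pos t⟩⟩ := by
  rcases s with ⟨t', ⟨j, hj⟩⟩ | ⟨t', j⟩
  · by_cases h : j + 1 < Z.la t'
    · simp only [finish, h, dite_true, ne_eq, Sum.inl.injEq, Sigma.mk.injEq, not_and]
      rintro rfl
      simp
    · simp [finish, h]
  · simp [finish]

lemma exists_finish_eq (y : Z.Pt) (hy : ∀ t, y ≠ Sum.inl ⟨t, ⟨0, Z.la_pos t⟩⟩) :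
    ∃ s, Z.finish s = y := by
  rcases y with ⟨t, ⟨j, hj⟩⟩ | y
  · cases j with
    | zero => exact absurd rfl (hy t)
    | succ n =>
      refine ⟨Sum.inl ⟨t, ⟨n, by omega⟩⟩, ?_⟩
      simp [finish, hj]
  · exact ⟨Sum.inr y, rfl⟩

variable [Fintype ι] [DecidableEq ι]

open Classical in
/-- The matrices by which vertices and arrows act on row vectors. -/
def mat : V ⊕ A → Matrix Z.Pt Z.Pt K
  | Sum.inl i => Matrix.diagonal fun z => if Z.vertex z = i then 1 else 0
  | Sum.inr α => Matrix.of fun y z =>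
      ∑ s : Z.Pt, if Z.label s = α ∧ Z.start s = y ∧ Z.finish s = z then Z.weight s else 0

lemma mat_apply_step (s : Z.Pt) (z : Z.Pt) [Decidable (Z.finish s = z)] :
    Z.mat (Sum.inr (Z.label s)) (Z.start s) z = if Z.finish s = z then Z.weight s else 0 := by
  classical
  simp only [mat, Matrix.of_apply]
  rw [Finset.sum_eq_single s]
  · simp
  · intro s' _ hs'
    exact if_neg fun h => hs' (Z.start_label_injective _ _ h.2.1 h.1)
  · simp

lemma mat_apply_finish (s : Z.Pt) (y : Z.Pt) [Decidable (Z.start s = y)] :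
    Z.mat (Sum.inr (Z.label s)) y (Z.finish s) = if Z.start s = y then Z.weight s else 0 := by
  classical
  simp only [mat, Matrix.of_apply]
  rw [Finset.sum_eq_single s]
  · simp
  · intro s' _ hs'
    exact if_neg fun h => hs' (Z.finish_label_injective _ _ h.2.2 h.1)
  · simp

lemma exists_step {α : A} {y z : Z.Pt} (h : Z.mat (Sum.inr α) y z ≠ 0) :
    ∃ s, Z.label s = α ∧ Z.start s = y ∧ Z.finish s = z := by
  obtain ⟨s, -, hs⟩ := Finset.exists_ne_zero_of_sum_ne_zero h
  exact ⟨s, by_contra fun hn => hs (if_neg hn)⟩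

/-- Only the socle relations depend on lengths and scalars, so they are left as hypotheses. The zero
relations of length two hold because consecutive steps carry labels `γ` and `σ γ`. -/
lemma lift_rel (q : A → Kˣ)
    (hone : ∀ α, (∀ β, Q.src β = Q.src α → β = α) →
      FreeAlgebra.lift K Z.mat (Q.cyc K α) = 0)
    (htwo : ∀ α β, Q.src α = Q.src β → α ≠ β →
      (q α : K) • FreeAlgebra.lift K Z.mat (Q.cyc K α) +
        (q β : K) • FreeAlgebra.lift K Z.mat (Q.cyc K β) = 0)
    ⦃x y : FreeAlgebra K (V ⊕ A)⦄ (h : Q.Rel q x y) :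
    FreeAlgebra.lift K Z.mat x = FreeAlgebra.lift K Z.mat y := by
  classical
  cases h with
  | idem i => simp [vert, mat]
  | orth i j hij =>
    simp only [vert, map_mul, FreeAlgebra.lift_ι_apply, mat, Matrix.diagonal_mul_diagonal,
      map_zero]
    ext y z
    by_cases hyz : y = z
    · subst hyz
      simp only [Matrix.diagonal_apply_eq, Matrix.zero_apply]
      by_cases h1 : Z.vertex y = i
      · simp [h1, hij]
      · simp [h1]
    · simp [hyz]
  | one =>
    simp only [vert, map_sum, FreeAlgebra.lift_ι_apply, mat, map_one]
    ext y z
    rw [Matrix.sum_apply]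
    by_cases hyz : y = z
    · subst hyz
      simp
    · simp [hyz]
  | src_mul α =>
    simp only [vert, arr, map_mul, FreeAlgebra.lift_ι_apply]
    ext y z
    simp only [mat, Matrix.diagonal_mul, Matrix.of_apply, Finset.mul_sum]
    refine Finset.sum_congr rfl fun s _ => ?_
    split_ifs with h1 h2 h2
    · simp
    · simp
    · exact absurd (by rw [← h2.2.1, Z.vertex_start, h2.1]) h1
    · simp
  | mul_tgt α =>
    simp only [vert, arr, map_mul, FreeAlgebra.lift_ι_apply]
    ext y z
    simp only [mat, Matrix.mul_diagonal, Matrix.of_apply, Finset.sum_mul]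
    refine Finset.sum_congr rfl fun s _ => ?_
    split_ifs with h1 h2 h2
    · simp
    · exact absurd (by rw [← h1.2.2, Z.vertex_finish, h1.1]) h2
    · simp
    · simp
  | zero α β _ hσ =>
    simp only [arr, map_mul, FreeAlgebra.lift_ι_apply, map_zero]
    ext y z
    by_contra hn
    obtain ⟨x, -, hx⟩ := Finset.exists_ne_zero_of_sum_ne_zero hn
    obtain ⟨s, hs1, -, hs3⟩ := Z.exists_step (left_ne_zero_of_mul hx)
    obtain ⟨s', hs1', hs2', -⟩ := Z.exists_step (right_ne_zero_of_mul hx)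
    exact hσ (by rw [← hs1, ← hs1', Z.label_of_finish_eq_start s s' (hs3.trans hs2'.symm)])
  | socle_two α β h1 h2 => simpa using htwo α β h1 h2
  | socle_one α h1 => simp [hone α h1]

end Zigzag
end SpecialBiserial

/-! ### The action on points, and admissible zigzags -/

namespace SpecialBiserial
namespace Zigzag
variable {V A : Type v} [Fintype V] [Fintype A] {Q : SpecialBiserial V A} {K : Type u} [Field K]
variable {ι : Type} [Fintype ι] [DecidableEq ι] (Z : Zigzag Q K ι)

open Matrix

lemma single_start_vecMul (s : Z.Pt) :
    Pi.single (Z.start s) (1 : K) ᵥ* Z.mat (Sum.inr (Z.label s)) =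
      Z.weight s • Pi.single (Z.finish s) (1 : K) := by
  ext z
  rw [single_one_vecMul, row_apply, Z.mat_apply_step, Pi.smul_apply, Pi.single_apply]
  simp [eq_comm]

lemma single_vecMul_eq_zero {y : Z.Pt} {γ : A} (h : ∀ s, Z.start s = y → Z.label s ≠ γ) :
    Pi.single y (1 : K) ᵥ* Z.mat (Sum.inr γ) = 0 := by
  ext z
  rw [single_one_vecMul, row_apply, Pi.zero_apply]
  by_contra hn
  obtain ⟨s, h1, h2, -⟩ := Z.exists_step hn
  exact h s h2 h1

lemma single_vecMul_vert (y : Z.Pt) (i : V) [Decidable (Z.vertex y = i)] :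
    Pi.single y (1 : K) ᵥ* Z.mat (Sum.inl i) =
      if Z.vertex y = i then Pi.single y (1 : K) else 0 := by
  classical
  ext z
  rw [single_one_vecMul, row_apply]
  simp only [mat]
  by_cases h : y = z
  · subst h
    by_cases h' : Z.vertex y = i <;> simp [h']
  · by_cases h' : Z.vertex y = i <;> simp [h, h', Ne.symm h]

lemma vecMul_finish (x : Z.Pt → K) (s : Z.Pt) :
    (x ᵥ* Z.mat (Sum.inr (Z.label s))) (Z.finish s) = Z.weight s * x (Z.start s) := by
  classical
  simp only [vecMul, dotProduct, mat_apply_finish]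
  simp [mul_comm]

lemma vecMul_eq_zero_of_finish_ne (x : Z.Pt → K) (γ : A) (z : Z.Pt) (hz : ∀ s, Z.finish s ≠ z) :
    (x ᵥ* Z.mat (Sum.inr γ)) z = 0 := by
  simp only [vecMul, dotProduct]
  refine Finset.sum_eq_zero fun y _ => ?_
  by_contra hn
  obtain ⟨s, -, -, h⟩ := Z.exists_step (right_ne_zero_of_mul hn)
  exact hz s h

lemma vecMul_vert_apply (x : Z.Pt → K) (i : V) (z : Z.Pt) [Decidable (Z.vertex z = i)] :
    (x ᵥ* Z.mat (Sum.inl i)) z = if Z.vertex z = i then x z else 0 := by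
  classical
  simp only [mat, vecMul_diagonal]
  by_cases h : Z.vertex z = i <;> simp [h]

/-- The basis vector at the `j`-th point of the path of `α t`, or zero beyond its end. -/
def av (t : ι) (j : ℕ) : Z.Pt → K :=
  if h : j < Z.la t then Pi.single (Sum.inl ⟨t, ⟨j, h⟩⟩) 1
  else if j = Z.la t then
    Pi.single (Sum.inr ⟨Z.τ t, ⟨Z.lb (Z.τ t) - 1, Nat.sub_lt (Z.lb_pos _) one_pos⟩⟩) 1
  else 0

/-- The basis vector at the `j`-th point of the path of `β s`, or zero beyond its end. -/
def bv (s : ι) : ℕ → Z.Pt → K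
  | 0 => Pi.single (Sum.inl ⟨Z.nx s, ⟨0, Z.la_pos _⟩⟩) 1
  | j + 1 => if h : j < Z.lb s then Pi.single (Sum.inr ⟨s, ⟨j, h⟩⟩) 1 else 0

lemma av_of_lt {t : ι} {j : ℕ} (h : j < Z.la t) :
    Z.av t j = Pi.single (Sum.inl ⟨t, ⟨j, h⟩⟩) 1 := dif_pos h

lemma av_eq_zero {t : ι} {j : ℕ} (h : Z.la t < j) : Z.av t j = 0 := by
  rw [av, dif_neg (by omega), if_neg (by omega)]

lemma bv_succ {s : ι} {j : ℕ} (h : j < Z.lb s) :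
    Z.bv s (j + 1) = Pi.single (Sum.inr ⟨s, ⟨j, h⟩⟩) 1 := dif_pos h

lemma bv_eq_zero {s : ι} {j : ℕ} (h : Z.lb s < j) : Z.bv s j = 0 := by
  cases j with
  | zero => omega
  | succ n => exact dif_neg (by omega)

lemma bv_zero (s : ι) : Z.bv s 0 = Z.av (Z.nx s) 0 := (Z.av_of_lt (Z.la_pos _)).symm

lemma av_la (t : ι) : Z.av t (Z.la t) = Z.bv (Z.τ t) (Z.lb (Z.τ t)) := by
  have h := Z.lb_pos (Z.τ t)
  rw [av, dif_neg (by omega), if_pos rfl]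
  obtain ⟨n, hn⟩ : ∃ n, Z.lb (Z.τ t) = n + 1 := ⟨Z.lb (Z.τ t) - 1, by omega⟩
  have := Z.bv_succ (s := Z.τ t) (j := n) (by omega)
  simp only [hn, Nat.add_sub_cancel]
  exact this.symm

lemma single_inl (y : Σ t, Fin (Z.la t)) :
    Pi.single (Sum.inl y) (1 : K) = Z.av y.1 y.2 := (Z.av_of_lt y.2.2).symm

lemma single_inr (y : Σ t, Fin (Z.lb t)) :
    Pi.single (Sum.inr y) (1 : K) = Z.bv y.1 (y.2 + 1) := (Z.bv_succ y.2.2).symm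

lemma single_finish_inl (t : ι) (j : Fin (Z.la t)) :
    Pi.single (Z.finish (Sum.inl ⟨t, j⟩)) (1 : K) = Z.av t (j + 1) := by
  by_cases h : (j : ℕ) + 1 < Z.la t
  · rw [Z.av_of_lt h]
    simp [finish, h]
  · rw [av, dif_neg h, if_pos (by omega)]
    simp [finish, h]

lemma single_start_inr (s : ι) (j : Fin (Z.lb s)) :
    Pi.single (Z.start (Sum.inr ⟨s, j⟩)) (1 : K) = Z.bv s j := by
  obtain ⟨j, hj⟩ := j
  cases j with
  | zero => simp [start, bv]
  | succ n => simp [start, Z.bv_succ (s := s) (j := n) (by omega)]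

lemma bv_lb_vecMul (s : ι) (γ : A) : Z.bv s (Z.lb s) ᵥ* Z.mat (Sum.inr γ) = 0 := by
  have h := Z.lb_pos s
  obtain ⟨n, hn⟩ : ∃ n, Z.lb s = n + 1 := ⟨Z.lb s - 1, by omega⟩
  rw [hn, Z.bv_succ (by omega)]
  refine Z.single_vecMul_eq_zero ?_
  rintro (⟨t, j⟩ | ⟨t, ⟨j, hj⟩⟩) h
  · simp [start] at h
  · cases j with
    | zero => simp [start] at h
    | succ k =>
      simp [start] at h
      obtain ⟨rfl, h⟩ := h
      simp at h
      omega

lemma av_la_vecMul (t : ι) (γ : A) : Z.av t (Z.la t) ᵥ* Z.mat (Sum.inr γ) = 0 := by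
  rw [av_la, bv_lb_vecMul]

lemma av_step (t : ι) (j : ℕ) :
    Z.av t j ᵥ* Z.mat (Sum.inr ((Q.σ ^ j) (Z.α t))) = (Z.wa t j : K) • Z.av t (j + 1) := by
  rcases lt_trichotomy j (Z.la t) with h | rfl | h
  · have := Z.single_start_vecMul (Sum.inl ⟨t, ⟨j, h⟩⟩)
    rw [single_finish_inl] at this
    rw [Z.av_of_lt h]
    exact this
  · rw [av_la_vecMul, Z.av_eq_zero (Nat.lt_succ_self _), smul_zero]
  · rw [Z.av_eq_zero h, Z.av_eq_zero (Nat.lt_succ_of_lt h), smul_zero, zero_vecMul]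

lemma bv_step (s : ι) (j : ℕ) :
    Z.bv s j ᵥ* Z.mat (Sum.inr ((Q.σ ^ j) (Z.β s))) = (Z.wb s j : K) • Z.bv s (j + 1) := by
  rcases lt_trichotomy j (Z.lb s) with h | rfl | h
  · have := Z.single_start_vecMul (Sum.inr ⟨s, ⟨j, h⟩⟩)
    rw [single_start_inr] at this
    rw [Z.bv_succ h]
    exact this
  · rw [bv_lb_vecMul, Z.bv_eq_zero (Nat.lt_succ_self _), smul_zero]
  · rw [Z.bv_eq_zero h, Z.bv_eq_zero (Nat.lt_succ_of_lt h), smul_zero, zero_vecMul]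

lemma av_vecMul_eq_zero {t : ι} {j : ℕ} (hj : 0 < j) {γ : A} (hγ : γ ≠ (Q.σ ^ j) (Z.α t)) :
    Z.av t j ᵥ* Z.mat (Sum.inr γ) = 0 := by
  rcases lt_trichotomy j (Z.la t) with h | rfl | h
  · rw [Z.av_of_lt h]
    refine Z.single_vecMul_eq_zero ?_
    rintro (⟨t', j'⟩ | ⟨t', ⟨j', hj'⟩⟩) h
    · simp only [start, Sum.inl.injEq] at h
      rw [h]
      exact hγ.symm
    · cases j' with
      | zero =>
        simp only [start, if_true, Sum.inl.injEq, Sigma.mk.injEq] at h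
        obtain ⟨rfl, h⟩ := h
        simp at h
        omega
      | succ k => simp [start] at h
  · rw [av_la_vecMul]
  · rw [Z.av_eq_zero h, zero_vecMul]

lemma bv_vecMul_eq_zero {s : ι} {j : ℕ} (hj : 0 < j) {γ : A} (hγ : γ ≠ (Q.σ ^ j) (Z.β s)) :
    Z.bv s j ᵥ* Z.mat (Sum.inr γ) = 0 := by
  obtain ⟨n, rfl⟩ : ∃ n, j = n + 1 := ⟨j - 1, by omega⟩
  by_cases h : n < Z.lb s
  · rw [Z.bv_succ h]
    refine Z.single_vecMul_eq_zero ?_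
    rintro (⟨t', j'⟩ | ⟨t', ⟨j', hj'⟩⟩) h
    · simp [start] at h
    · cases j' with
      | zero => simp [start] at h
      | succ k =>
        simp [start] at h
        obtain ⟨rfl, h⟩ := h
        simp at h
        subst h
        exact hγ.symm
  · rw [Z.bv_eq_zero (by omega), zero_vecMul]

lemma av_zero_vecMul_eq_zero {t : ι} {γ : A} (h1 : γ ≠ Z.α t) (h2 : ∀ s, Z.nx s = t → γ ≠ Z.β s) :
    Z.av t 0 ᵥ* Z.mat (Sum.inr γ) = 0 := by
  rw [Z.av_of_lt (Z.la_pos t)]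
  refine Z.single_vecMul_eq_zero ?_
  rintro (⟨t', j'⟩ | ⟨t', ⟨j', hj'⟩⟩) h
  · simp only [start, Sum.inl.injEq] at h
    rw [h]
    exact h1.symm
  · cases j' with
    | zero =>
      simp only [start, if_true, Sum.inl.injEq, Sigma.mk.injEq] at h
      exact (h2 t' h.1).symm
    | succ k => simp [start] at h

lemma bv_vecMul_vert (s : ι) (j : ℕ) :
    Z.bv s j ᵥ* Z.mat (Sum.inl (Q.src ((Q.σ ^ j) (Z.β s)))) = Z.bv s j := by
  classical
  cases j with
  | zero =>
    rw [bv, single_vecMul_vert, if_pos]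
    exact (Z.src_head s).symm
  | succ n =>
    by_cases h : n < Z.lb s
    · rw [Z.bv_succ h, single_vecMul_vert, if_pos]
      exact (Q.src_pow_succ _ _).symm
    · rw [Z.bv_eq_zero (by omega), zero_vecMul]

lemma av_vecMul_vert (t : ι) (j : ℕ) :
    Z.av t j ᵥ* Z.mat (Sum.inl (Q.src ((Q.σ ^ j) (Z.α t)))) = Z.av t j := by
  classical
  rcases lt_trichotomy j (Z.la t) with h | rfl | h
  · rw [Z.av_of_lt h, single_vecMul_vert, if_pos]
    rfl
  · rw [av_la, ← Z.src_end, bv_vecMul_vert]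
  · rw [Z.av_eq_zero h, zero_vecMul]

/-- Points past the end of a path are zero by convention, so no bound on `j + n` is needed. -/
lemma av_run (t : ι) (j n : ℕ) :
    Z.av t j ᵥ* FreeAlgebra.lift K Z.mat (Q.run K ((Q.σ ^ j) (Z.α t)) n) =
      (∏ i ∈ Finset.range n, (Z.wa t (j + i) : K)) • Z.av t (j + n) := by
  induction n with
  | zero => simp [run_zero]
  | succ n ih =>
    rw [run_succ, map_mul, ← vecMul_vecMul, ih, arr, FreeAlgebra.lift_ι_apply,
      ← Equiv.Perm.mul_apply, ← pow_add, add_comm n j, smul_vecMul, av_step, smul_smul,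
      Finset.prod_range_succ, add_assoc]

lemma bv_run (s : ι) (j n : ℕ) :
    Z.bv s j ᵥ* FreeAlgebra.lift K Z.mat (Q.run K ((Q.σ ^ j) (Z.β s)) n) =
      (∏ i ∈ Finset.range n, (Z.wb s (j + i) : K)) • Z.bv s (j + n) := by
  induction n with
  | zero => simp [run_zero]
  | succ n ih =>
    rw [run_succ, map_mul, ← vecMul_vecMul, ih, arr, FreeAlgebra.lift_ι_apply,
      ← Equiv.Perm.mul_apply, ← pow_add, add_comm n j, smul_vecMul, bv_step, smul_smul,
      Finset.prod_range_succ, add_assoc]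

lemma vecMul_run_eq_zero {x : Z.Pt → K} {γ : A} {n : ℕ} (hn : 0 < n)
    (h : x ᵥ* Z.mat (Sum.inr γ) = 0) : x ᵥ* FreeAlgebra.lift K Z.mat (Q.run K γ n) = 0 := by
  obtain ⟨m, rfl⟩ : ∃ m, n = m + 1 := ⟨n - 1, by omega⟩
  rw [run_succ', map_mul, ← vecMul_vecMul, arr, FreeAlgebra.lift_ι_apply, h, zero_vecMul]

/-- The paths of the zigzag are initial subpaths of the closed paths of the socle relations, and
the socle relations hold at the tops of the zigzag. -/
structure Admissible (q : A → Kˣ) : Prop where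
  la_le : ∀ t, Z.la t ≤ Q.len (Z.α t)
  lb_le : ∀ s, Z.lb s ≤ Q.len (Z.β s)
  socle : ∀ s, (q (Z.α (Z.nx s)) : K) •
      ((∏ i ∈ Finset.range (Q.len (Z.α (Z.nx s))), (Z.wa (Z.nx s) i : K)) •
        Z.av (Z.nx s) (Q.len (Z.α (Z.nx s)))) +
    (q (Z.β s) : K) • ((∏ i ∈ Finset.range (Q.len (Z.β s)), (Z.wb s i : K)) •
      Z.bv s (Q.len (Z.β s))) = 0

variable {Z}

lemma len_pos (γ : A) : 0 < Q.len γ := lt_of_lt_of_le two_pos (Q.two_le γ)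

/-- A closed path started strictly below a top overruns the end, since `la t` is at most its length.
This leaves only the tops to be examined in the socle relations. -/
lemma av_cyc_of_pos {q : A → Kˣ} (h : Z.Admissible q) (γ : A) (t : ι) {j : ℕ} (hj : 0 < j) :
    Z.av t j ᵥ* FreeAlgebra.lift K Z.mat (Q.cyc K γ) = 0 := by
  rw [cyc_eq_run]
  by_cases hγ : γ = (Q.σ ^ j) (Z.α t)
  · have := h.la_le t
    rw [hγ, BandWord.len_pow, av_run, Z.av_eq_zero (by omega), smul_zero]
  · exact Z.vecMul_run_eq_zero (len_pos γ) (Z.av_vecMul_eq_zero hj hγ)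

lemma bv_cyc_of_pos {q : A → Kˣ} (h : Z.Admissible q) (γ : A) (t : ι) {j : ℕ} (hj : 0 < j) :
    Z.bv t j ᵥ* FreeAlgebra.lift K Z.mat (Q.cyc K γ) = 0 := by
  rw [cyc_eq_run]
  by_cases hγ : γ = (Q.σ ^ j) (Z.β t)
  · have := h.lb_le t
    rw [hγ, BandWord.len_pow, bv_run, Z.bv_eq_zero (by omega), smul_zero]
  · exact Z.vecMul_run_eq_zero (len_pos γ) (Z.bv_vecMul_eq_zero hj hγ)

lemma av_zero_cyc (t : ι) (γ : A) (h1 : γ ≠ Z.α t) (h2 : γ ≠ Z.β (Z.nx.symm t)) :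
    Z.av t 0 ᵥ* FreeAlgebra.lift K Z.mat (Q.cyc K γ) = 0 := by
  rw [cyc_eq_run]
  refine Z.vecMul_run_eq_zero (len_pos γ) (Z.av_zero_vecMul_eq_zero h1 fun s hs => ?_)
  rwa [← hs, Equiv.symm_apply_apply] at h2

/-- A matrix vanishes if it kills the tops of the zigzag and the other points. -/
lemma matrix_eq_zero {M : Matrix Z.Pt Z.Pt K} (h0 : ∀ t, Z.av t 0 ᵥ* M = 0)
    (ha : ∀ t j, 0 < j → Z.av t j ᵥ* M = 0) (hb : ∀ t j, 0 < j → Z.bv t j ᵥ* M = 0) : M = 0 := by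
  ext y z
  have : Pi.single y (1 : K) ᵥ* M = 0 := by
    rcases y with y | y
    · rw [single_inl]
      rcases Nat.eq_zero_or_pos (y.2 : ℕ) with h | h
      · rw [h, h0]
      · exact ha _ _ h
    · rw [single_inr]
      exact hb _ _ (Nat.succ_pos _)
  rw [single_one_vecMul] at this
  exact congrFun this z

lemma Admissible.socle' {q : A → Kˣ} (h : Z.Admissible q) (s : ι) :
    Z.av (Z.nx s) 0 ᵥ* ((q (Z.α (Z.nx s)) : K) • FreeAlgebra.lift K Z.mat (Q.cyc K (Z.α (Z.nx s))) +
        (q (Z.β s) : K) • FreeAlgebra.lift K Z.mat (Q.cyc K (Z.β s))) = 0 := by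
  have h1 := Z.av_run (Z.nx s) 0 (Q.len (Z.α (Z.nx s)))
  have h2 := Z.bv_run s 0 (Q.len (Z.β s))
  simp only [pow_zero, Equiv.Perm.one_apply, zero_add] at h1 h2
  rw [cyc_eq_run, cyc_eq_run, vecMul_add, vecMul_smul, vecMul_smul, h1]
  rw [bv_zero] at h2
  rw [h2]
  exact h.socle s

/-- Two different arrows start at the vertex of every top. So no top lies at a vertex of valency
one, and at a vertex of valency two the relation is, up to order, the one assumed in `Admissible`.
-/
lemma Admissible.lift_rel {q : A → Kˣ} (h : Z.Admissible q) ⦃x y : FreeAlgebra K (V ⊕ A)⦄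
    (hxy : Q.Rel q x y) : FreeAlgebra.lift K Z.mat x = FreeAlgebra.lift K Z.mat y := by
  refine Z.lift_rel q (fun γ hγ => ?_) (fun γ δ hs hne => ?_) hxy
  · refine matrix_eq_zero (fun t => ?_) (fun t j hj => av_cyc_of_pos h γ t hj)
      (fun t j hj => bv_cyc_of_pos h γ t hj)
    have hs := Z.src_head (Z.nx.symm t)
    have hn := Z.head_ne (Z.nx.symm t)
    rw [Equiv.apply_symm_apply] at hs hn
    refine av_zero_cyc t γ ?_ ?_
    · rintro rfl
      exact hn (hγ _ hs)
    · rintro rfl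
      exact hn (hγ _ hs.symm).symm
  · refine matrix_eq_zero (fun t => ?_) (fun t j hj => ?_) (fun t j hj => ?_)
    · have hs' := Z.src_head (Z.nx.symm t)
      have hn := Z.head_ne (Z.nx.symm t)
      have hz := h.socle' (Z.nx.symm t)
      rw [Equiv.apply_symm_apply] at hs' hn hz
      by_cases h1 : Q.src γ = Q.src (Z.α t)
      · rcases Q.eq_or_eq_of_src_eq hn.symm hs' h1 with rfl | rfl <;>
        rcases Q.eq_or_eq_of_src_eq hn.symm hs' (hs.symm.trans h1) with rfl | rfl
        · exact absurd rfl hne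
        · exact hz
        · rw [add_comm]
          exact hz
        · exact absurd rfl hne
      · rw [vecMul_add, vecMul_smul, vecMul_smul, av_zero_cyc t γ, av_zero_cyc t δ]
        · simp
        · rintro rfl
          exact h1 hs
        · rintro rfl
          exact h1 (hs.trans hs')
        · rintro rfl
          exact h1 rfl
        · rintro rfl
          exact h1 hs'
    · rw [vecMul_add, vecMul_smul, vecMul_smul, av_cyc_of_pos h γ t hj, av_cyc_of_pos h δ t hj]
      simp
    · rw [vecMul_add, vecMul_smul, vecMul_smul, bv_cyc_of_pos h γ t hj, bv_cyc_of_pos h δ t hj]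
      simp

end Zigzag
end SpecialBiserial

/-! ### Uniqueness of projective covers, and splicing -/

section Covers

variable {R : Type w} [Ring R]

/-- The kernels of projective covers of isomorphic modules are isomorphic. -/
lemma IsSuperfluous.nonempty_ker_equiv {P : Type x} {P' : Type y} {N N' : Type*}
    [AddCommGroup P] [Module R P] [AddCommGroup P'] [Module R P'] [AddCommGroup N] [Module R N]
    [AddCommGroup N'] [Module R N'] [Module.Projective R P] [Module.Projective R P']
    {f : P →ₗ[R] N} {f' : P' →ₗ[R] N'} (hf : Function.Surjective f)
    (hf' : Function.Surjective f') (hk : IsSuperfluous (LinearMap.ker f))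
    (hk' : IsSuperfluous (LinearMap.ker f')) (e : N ≃ₗ[R] N') :
    Nonempty (LinearMap.ker f ≃ₗ[R] LinearMap.ker f') := by
  obtain ⟨g, hg⟩ := Module.projective_lifting_property f' (e.toLinearMap ∘ₗ f) hf'
  have hg' : ∀ p, f' (g p) = e (f p) := fun p => LinearMap.congr_fun hg p
  -- The image of the lift `g` together with the superfluous kernel of `f'` is everything.
  have hgs : Function.Surjective g := by
    rw [← LinearMap.range_eq_top]
    refine hk' _ (eq_top_iff.2 fun p' _ => ?_)
    obtain ⟨p, hp⟩ := hf (e.symm (f' p'))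
    rw [← sub_add_cancel p' (g p)]
    refine Submodule.add_mem_sup ?_ ⟨p, rfl⟩
    rw [LinearMap.mem_ker, map_sub, hg', hp, LinearEquiv.apply_symm_apply, sub_self]
  obtain ⟨s, hs⟩ := Module.projective_lifting_property g LinearMap.id hgs
  have hs' : ∀ p', g (s p') = p' := fun p' => LinearMap.congr_fun hs p'
  -- The difference `p - s (g p)` lies in the kernel of `f`, which is superfluous too. So the
  -- section `s` is onto, and `g` is bijective.
  have hss : Function.Surjective s := by
    rw [← LinearMap.range_eq_top]
    refine hk _ (eq_top_iff.2 fun p _ => ?_)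
    rw [← sub_add_cancel p (s (g p))]
    refine Submodule.add_mem_sup ?_ ⟨g p, rfl⟩
    rw [LinearMap.mem_ker, map_sub, sub_eq_zero]
    exact e.injective (by rw [← hg', ← hg', hs'])
  have hgi : Function.Injective g := by
    intro p p' h
    obtain ⟨r, rfl⟩ := hss p
    obtain ⟨r', rfl⟩ := hss p'
    rw [hs', hs'] at h
    rw [h]
  let G : P ≃ₗ[R] P' := LinearEquiv.ofBijective g ⟨hgi, hgs⟩
  have hG : LinearMap.ker f = (LinearMap.ker f').comap G.toLinearMap := by
    ext p
    have : G p = g p := rfl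
    simp [this, hg']
  exact ⟨(LinearEquiv.ofEq _ _ hG).trans (G.ofSubmodule' (LinearMap.ker f'))⟩

/-- Projective covers `P n → X n` with kernels `X (n + 1)`. -/
structure CoverSequence (R : Type w) [Ring R] (X : ℕ → Type x) [∀ n, AddCommGroup (X n)]
    [∀ n, Module R (X n)] where
  P : ℕ → Type y
  [addCommGroup : ∀ n, AddCommGroup (P n)]
  [module : ∀ n, Module R (P n)]
  aug : ∀ n, P n →ₗ[R] X n
  inc : ∀ n, X (n + 1) →ₗ[R] P n
  projective : ∀ n, Module.Projective R (P n)
  surjective_aug : ∀ n, Function.Surjective (aug n)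
  injective_inc : ∀ n, Function.Injective (inc n)
  exact_inc_aug : ∀ n, Function.Exact (inc n) (aug n)
  minimal : ∀ n, IsSuperfluous (LinearMap.ker (aug n))

namespace CoverSequence

attribute [instance] addCommGroup module

variable {X : ℕ → Type x} [∀ n, AddCommGroup (X n)] [∀ n, Module R (X n)]

lemma nonempty_ker_aug_equiv (C : CoverSequence.{w, x, y} R X) (n : ℕ) :
    Nonempty (LinearMap.ker (C.aug n) ≃ₗ[R] X (n + 1)) :=
  ⟨((LinearEquiv.ofInjective _ (C.injective_inc n)).trans
    (LinearEquiv.ofEq _ _ (LinearMap.exact_iff.1 (C.exact_inc_aug n)).symm)).symm⟩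

/-- The minimal projective resolution obtained by splicing. -/
def resolution (C : CoverSequence.{w, x, w} R X) {M : Type*} [AddCommGroup M] [Module R M]
    (e : M ≃ₗ[R] X 0) : MinimalProjectiveResolution R M where
  P := C.P
  aug := e.symm.toLinearMap ∘ₗ C.aug 0
  d n := C.inc n ∘ₗ C.aug (n + 1)
  projective := C.projective
  surjective_aug := e.symm.surjective.comp (C.surjective_aug 0)
  exact_aug := by
    rw [LinearMap.exact_iff, LinearMap.range_comp_of_range_eq_top _
      (LinearMap.range_eq_top.2 (C.surjective_aug 1)), LinearEquiv.ker_comp]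
    exact LinearMap.exact_iff.1 (C.exact_inc_aug 0)
  exact_d n := by
    rw [LinearMap.exact_iff, LinearMap.range_comp_of_range_eq_top _
      (LinearMap.range_eq_top.2 (C.surjective_aug (n + 2))),
      LinearMap.ker_comp_of_ker_eq_bot _ (LinearMap.ker_eq_bot.2 (C.injective_inc n))]
    exact LinearMap.exact_iff.1 (C.exact_inc_aug (n + 1))
  minimal_aug := by
    rw [LinearEquiv.ker_comp]
    exact C.minimal 0
  minimal_d n := by
    rw [LinearMap.ker_comp_of_ker_eq_bot _ (LinearMap.ker_eq_bot.2 (C.injective_inc n))]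
    exact C.minimal (n + 1)

/-- Needed for an arbitrary `Y`, since periodicity may be witnessed by any minimal resolution. The
syzygies are compared one at a time by uniqueness of projective covers. -/
lemma nonempty_syzygy_equiv (C : CoverSequence.{w, x, y} R X) {M : Type*} [AddCommGroup M]
    [Module R M] (e : M ≃ₗ[R] X 0) (Y : MinimalProjectiveResolution R M) (n : ℕ) :
    Nonempty (Y.syzygy n ≃ₗ[R] X (n + 1)) := by
  have := Y.projective
  have := C.projective
  induction n with
  | zero =>
    obtain ⟨e'⟩ := Y.minimal_aug.nonempty_ker_equiv Y.surjective_aug (C.surjective_aug 0)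
      (C.minimal 0) e
    obtain ⟨e''⟩ := C.nonempty_ker_aug_equiv 0
    exact ⟨e'.trans e''⟩
  | succ n ih =>
    obtain ⟨e⟩ := ih
    have hmem : ∀ p, Y.d n p ∈ Y.syzygy n := by
      intro p
      cases n with
      | zero => exact (Y.exact_aug _).2 ⟨p, rfl⟩
      | succ n => exact (Y.exact_d n _).2 ⟨p, rfl⟩
    -- By exactness the differential is a projective cover of the previous syzygy; it replaces `d n`
    -- so that covers of isomorphic modules are compared.
    let f : Y.P (n + 1) →ₗ[R] Y.syzygy n := (Y.d n).codRestrict _ hmem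
    have hf : Function.Surjective f := by
      rintro ⟨z, hz⟩
      cases n with
      | zero =>
        obtain ⟨p, hp⟩ := (Y.exact_aug z).1 hz
        exact ⟨p, Subtype.ext hp⟩
      | succ n =>
        obtain ⟨p, hp⟩ := (Y.exact_d n z).1 hz
        exact ⟨p, Subtype.ext hp⟩
    have hk : LinearMap.ker f = LinearMap.ker (Y.d n) := LinearMap.ker_codRestrict _ _ _
    have hm : IsSuperfluous (LinearMap.ker f) := by
      rw [hk]
      exact Y.minimal_d n
    obtain ⟨e'⟩ := hm.nonempty_ker_equiv hf (C.surjective_aug (n + 1)) (C.minimal (n + 1)) e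
    obtain ⟨e''⟩ := C.nonempty_ker_aug_equiv (n + 1)
    exact ⟨((LinearEquiv.ofEq _ _ hk.symm).trans e').trans e''⟩

/-- If `X 0` were projective, its cover would split by a section that is onto because the kernel is
superfluous. The kernel, a copy of `X 1`, would then vanish. -/
lemma not_projective (C : CoverSequence.{w, x, y} R X) [Nontrivial (X 1)] :
    ¬ Module.Projective R (X 0) := by
  intro h
  obtain ⟨s, hs⟩ := Module.projective_lifting_property (C.aug 0) LinearMap.id (C.surjective_aug 0)
  have hs' : ∀ p', C.aug 0 (s p') = p' := fun p' => LinearMap.congr_fun hs p'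
  have hss : Function.Surjective s := by
    rw [← LinearMap.range_eq_top]
    refine C.minimal 0 _ (eq_top_iff.2 fun p _ => ?_)
    rw [← sub_add_cancel p (s (C.aug 0 p))]
    refine Submodule.add_mem_sup ?_ ⟨_, rfl⟩
    rw [LinearMap.mem_ker, map_sub, hs', sub_self]
  obtain ⟨z, hz⟩ := exists_ne (0 : X 1)
  obtain ⟨r, hr⟩ := hss (C.inc 0 z)
  have h0 : C.aug 0 (C.inc 0 z) = 0 := (C.exact_inc_aug 0 _).2 ⟨z, rfl⟩
  rw [← hr, hs'] at h0
  rw [h0, map_zero] at hr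
  exact hz (C.injective_inc 0 (by rw [← hr, map_zero]))

end CoverSequence
end Covers

/-! ### Zigzag modules over the algebra, and their universal property -/

namespace SpecialBiserial

variable {V A : Type v} [Fintype V] [Fintype A] {Q : SpecialBiserial V A} {K : Type u} [Field K]

variable (Q) in
/-- The class of an element of the free algebra, in the opposite algebra of `Λ_q`. -/
def opMk (q : A → Kˣ) (z : FreeAlgebra K (V ⊕ A)) : (Q.Alg q)ᵐᵒᵖ :=
  MulOpposite.op (RingQuot.mkAlgHom K (Q.Rel q) z)

lemma opMk_surjective (q : A → Kˣ) : Function.Surjective (Q.opMk q) := fun r => by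
  obtain ⟨z, hz⟩ := RingQuot.mkAlgHom_surjective K (Q.Rel q) r.unop
  exact ⟨z, MulOpposite.unop_injective hz⟩

lemma opMk_mul (q : A → Kˣ) (z z' : FreeAlgebra K (V ⊕ A)) :
    Q.opMk q (z * z') = Q.opMk q z' * Q.opMk q z := by
  simp [opMk]

lemma opMk_add (q : A → Kˣ) (z z' : FreeAlgebra K (V ⊕ A)) :
    Q.opMk q (z + z') = Q.opMk q z + Q.opMk q z' := by
  simp [opMk]

lemma opMk_smul (q : A → Kˣ) (c : K) (z : FreeAlgebra K (V ⊕ A)) :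
    Q.opMk q (c • z) = c • Q.opMk q z := by
  simp [opMk]

lemma opMk_zero (q : A → Kˣ) : Q.opMk q 0 = 0 := by simp [opMk]

lemma opMk_algebraMap (q : A → Kˣ) (c : K) :
    Q.opMk q (algebraMap K _ c) = algebraMap K _ c := by
  simp [opMk]

lemma opMk_eq_of_rel {q : A → Kˣ} {z z' : FreeAlgebra K (V ⊕ A)} (h : Q.Rel q z z') :
    Q.opMk q z = Q.opMk q z' :=
  congrArg MulOpposite.op (RingQuot.mkAlgHom_rel K h)

section GenLinear

variable {q : A → Kˣ} {X Y : Type*} [AddCommGroup X] [AddCommGroup Y] [Module K X] [Module K Y]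
  [Module (Q.Alg q)ᵐᵒᵖ X] [Module (Q.Alg q)ᵐᵒᵖ Y] [IsScalarTower K (Q.Alg q)ᵐᵒᵖ X]
  [IsScalarTower K (Q.Alg q)ᵐᵒᵖ Y]

lemma map_smul_of_generators (f : Y →ₗ[K] X)
    (hv : ∀ i y, f (Q.opMk q (vert K i) • y) = Q.opMk q (vert K i) • f y)
    (ha : ∀ α y, f (Q.opMk q (arr K α) • y) = Q.opMk q (arr K α) • f y)
    (r : (Q.Alg q)ᵐᵒᵖ) (y : Y) : f (r • y) = r • f y := by
  obtain ⟨z, rfl⟩ := opMk_surjective q r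
  induction z using FreeAlgebra.induction generalizing y with
  | grade0 c => rw [opMk_algebraMap, algebraMap_smul, algebraMap_smul, map_smul]
  | grade1 g =>
    rcases g with i | α
    · exact hv i y
    · exact ha α y
  | mul a b h1 h2 => rw [opMk_mul, mul_smul, mul_smul, h2, h1]
  | add a b h1 h2 => rw [opMk_add, add_smul, add_smul, map_add, h2, h1]

lemma opMk_vert_vert_smul {i j : V} (hij : i ≠ j) {x : X} (hx : Q.opMk q (vert K i) • x = x) :
    Q.opMk q (vert K j) • x = 0 := by
  rw [← hx, ← mul_smul, ← opMk_mul, opMk_eq_of_rel (Rel.orth i j hij), opMk_zero, zero_smul]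

lemma opMk_arr_smul_eq_zero {i : V} {γ : A} (hij : i ≠ Q.src γ) {x : X}
    (hx : Q.opMk q (vert K i) • x = x) : Q.opMk q (arr K γ) • x = 0 := by
  rw [← opMk_eq_of_rel (Rel.src_mul γ), opMk_mul, mul_smul, opMk_vert_vert_smul hij hx, smul_zero]

end GenLinear

namespace Zigzag

variable {ι : Type} [Fintype ι] [DecidableEq ι] {Z : Zigzag Q K ι} {q : A → Kˣ}

open Matrix

/-- The representation of `Λ_q` on row vectors. -/
def rep (h : Z.Admissible q) : Q.Alg q →ₐ[K] Matrix Z.Pt Z.Pt K :=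
  RingQuot.liftAlgHom K ⟨FreeAlgebra.lift K Z.mat, h.lift_rel⟩

/-- The right module of a zigzag. -/
def Mod (_h : Z.Admissible q) : Type u := Z.Pt → K

variable (h : Z.Admissible q)

instance : AddCommGroup (Mod h) := inferInstanceAs (AddCommGroup (Z.Pt → K))

instance : Module K (Mod h) := inferInstanceAs (Module K (Z.Pt → K))

instance : Module (Q.Alg q)ᵐᵒᵖ (Mod h) where
  smul x y := Matrix.vecMul (y : Z.Pt → K) (rep h x.unop)
  one_smul y :=
    (congrArg (Matrix.vecMul (y : Z.Pt → K)) (map_one (rep h))).trans (Matrix.vecMul_one _)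
  mul_smul x x' y :=
    (congrArg (Matrix.vecMul (y : Z.Pt → K)) (map_mul (rep h) x'.unop x.unop)).trans
      (Matrix.vecMul_vecMul _ _ _).symm
  smul_zero _ := Matrix.zero_vecMul _
  smul_add _ _ _ := Matrix.add_vecMul _ _ _
  add_smul x x' y :=
    (congrArg (Matrix.vecMul (y : Z.Pt → K)) (map_add (rep h) x.unop x'.unop)).trans
      (Matrix.vecMul_add _ _ _)
  zero_smul y :=
    (congrArg (Matrix.vecMul (y : Z.Pt → K)) (map_zero (rep h))).trans (Matrix.vecMul_zero _)

instance : IsScalarTower K (Q.Alg q)ᵐᵒᵖ (Mod h) where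
  smul_assoc c r y := by
    have h1 : rep h (c • r).unop = c • rep h r.unop := map_smul (rep h) c r.unop
    exact (congrArg (Matrix.vecMul (y : Z.Pt → K)) h1).trans (Matrix.vecMul_smul _ _ _)

lemma opMk_smul_eq (z : FreeAlgebra K (V ⊕ A)) (y : Mod h) :
    Q.opMk q z • y = ((y : Z.Pt → K) ᵥ* FreeAlgebra.lift K Z.mat z : Z.Pt → K) :=
  congrArg (Matrix.vecMul (y : Z.Pt → K)) (RingQuot.liftAlgHom_mkAlgHom_apply K _ _ z)

lemma opMk_arr_smul_eq (γ : A) (y : Mod h) :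
    Q.opMk q (arr K γ) • y = ((y : Z.Pt → K) ᵥ* Z.mat (Sum.inr γ) : Z.Pt → K) := by
  rw [opMk_smul_eq, arr, FreeAlgebra.lift_ι_apply]

lemma opMk_vert_smul_eq (i : V) (y : Mod h) :
    Q.opMk q (vert K i) • y = ((y : Z.Pt → K) ᵥ* Z.mat (Sum.inl i) : Z.Pt → K) := by
  rw [opMk_smul_eq, vert, FreeAlgebra.lift_ι_apply]

/-- The point `j` of the path of `α t`, as an element of the module. -/
def amod (t : ι) (j : ℕ) : Mod h := Z.av t j

/-- The point `j` of the path of `β s`, as an element of the module. -/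
def bmod (s : ι) (j : ℕ) : Mod h := Z.bv s j

lemma bmod_zero (s : ι) : bmod h s 0 = amod h (Z.nx s) 0 := Z.bv_zero s

lemma amod_la (t : ι) : amod h t (Z.la t) = bmod h (Z.τ t) (Z.lb (Z.τ t)) := Z.av_la t

lemma amod_eq_zero {t : ι} {j : ℕ} (hj : Z.la t < j) : amod h t j = 0 := Z.av_eq_zero hj

lemma bmod_eq_zero {t : ι} {j : ℕ} (hj : Z.lb t < j) : bmod h t j = 0 := Z.bv_eq_zero hj

lemma amod_step (t : ι) (j : ℕ) :
    Q.opMk q (arr K ((Q.σ ^ j) (Z.α t))) • amod h t j = (Z.wa t j : K) • amod h t (j + 1) := by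
  rw [opMk_arr_smul_eq]
  exact Z.av_step t j

lemma bmod_step (t : ι) (j : ℕ) :
    Q.opMk q (arr K ((Q.σ ^ j) (Z.β t))) • bmod h t j = (Z.wb t j : K) • bmod h t (j + 1) := by
  rw [opMk_arr_smul_eq]
  exact Z.bv_step t j

lemma amod_smul_eq_zero {t : ι} {j : ℕ} (hj : 0 < j) {γ : A} (hγ : γ ≠ (Q.σ ^ j) (Z.α t)) :
    Q.opMk q (arr K γ) • amod h t j = 0 := by
  rw [opMk_arr_smul_eq]
  exact Z.av_vecMul_eq_zero hj hγ

lemma bmod_smul_eq_zero {t : ι} {j : ℕ} (hj : 0 < j) {γ : A} (hγ : γ ≠ (Q.σ ^ j) (Z.β t)) :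
    Q.opMk q (arr K γ) • bmod h t j = 0 := by
  rw [opMk_arr_smul_eq]
  exact Z.bv_vecMul_eq_zero hj hγ

lemma amod_zero_smul_eq_zero {t : ι} {γ : A} (h1 : γ ≠ Z.α t)
    (h2 : ∀ s, Z.nx s = t → γ ≠ Z.β s) : Q.opMk q (arr K γ) • amod h t 0 = 0 := by
  rw [opMk_arr_smul_eq]
  exact Z.av_zero_vecMul_eq_zero h1 h2

lemma bmod_lb_smul (s : ι) (γ : A) : Q.opMk q (arr K γ) • bmod h s (Z.lb s) = 0 := by
  rw [opMk_arr_smul_eq]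
  exact Z.bv_lb_vecMul s γ

lemma amod_vert (t : ι) (j : ℕ) :
    Q.opMk q (vert K (Q.src ((Q.σ ^ j) (Z.α t)))) • amod h t j = amod h t j := by
  rw [opMk_vert_smul_eq]
  exact Z.av_vecMul_vert t j

lemma bmod_vert (t : ι) (j : ℕ) :
    Q.opMk q (vert K (Q.src ((Q.σ ^ j) (Z.β t)))) • bmod h t j = bmod h t j := by
  rw [opMk_vert_smul_eq]
  exact Z.bv_vecMul_vert t j

lemma amod_run (t : ι) (n : ℕ) : Q.opMk q (Q.run K (Z.α t) n) • amod h t 0 =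
    (∏ i ∈ Finset.range n, (Z.wa t i : K)) • amod h t n := by
  rw [opMk_smul_eq]
  have := Z.av_run t 0 n
  simp only [pow_zero, Equiv.Perm.one_apply, zero_add] at this
  exact this

lemma bmod_run (s : ι) (n : ℕ) : Q.opMk q (Q.run K (Z.β s) n) • bmod h s 0 =
    (∏ i ∈ Finset.range n, (Z.wb s i : K)) • bmod h s n := by
  rw [opMk_smul_eq]
  have := Z.bv_run s 0 n
  simp only [pow_zero, Equiv.Perm.one_apply, zero_add] at this
  exact this

/-- The basis of points. -/
def basis : Module.Basis Z.Pt K (Mod h) := Pi.basisFun K Z.Pt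

lemma basis_inl (y : Σ t, Fin (Z.la t)) : basis h (Sum.inl y) = amod h y.1 y.2 :=
  (Pi.basisFun_apply _ _ _).trans (Z.single_inl y)

lemma basis_inr (y : Σ t, Fin (Z.lb t)) : basis h (Sum.inr y) = bmod h y.1 (y.2 + 1) :=
  (Pi.basisFun_apply _ _ _).trans (Z.single_inr y)

variable {X : Type*} [AddCommGroup X] [Module K X] [Module (Q.Alg q)ᵐᵒᵖ X]
  [IsScalarTower K (Q.Alg q)ᵐᵒᵖ X]

/-- Elements of a module that behave like the points of a zigzag. -/
structure IsZigzag (Z : Zigzag Q K ι) (q : A → Kˣ) {X : Type*} [AddCommGroup X] [Module K X]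
    [Module (Q.Alg q)ᵐᵒᵖ X] (Fa Fb : ι → ℕ → X) : Prop where
  top : ∀ s, Fb s 0 = Fa (Z.nx s) 0
  socle : ∀ t, Fa t (Z.la t) = Fb (Z.τ t) (Z.lb (Z.τ t))
  a_step : ∀ t j, j < Z.la t →
    Q.opMk q (arr K ((Q.σ ^ j) (Z.α t))) • Fa t j = (Z.wa t j : K) • Fa t (j + 1)
  b_step : ∀ s j, j < Z.lb s →
    Q.opMk q (arr K ((Q.σ ^ j) (Z.β s))) • Fb s j = (Z.wb s j : K) • Fb s (j + 1)
  a_vert : ∀ t j, j < Z.la t → Q.opMk q (vert K (Q.src ((Q.σ ^ j) (Z.α t)))) • Fa t j = Fa t j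
  b_vert : ∀ s j, 0 < j → j ≤ Z.lb s →
    Q.opMk q (vert K (Q.src ((Q.σ ^ j) (Z.β s)))) • Fb s j = Fb s j
  top_zero : ∀ t γ, γ ≠ Z.α t → (∀ s, Z.nx s = t → γ ≠ Z.β s) → Q.opMk q (arr K γ) • Fa t 0 = 0
  a_zero : ∀ t j γ, 0 < j → j < Z.la t → γ ≠ (Q.σ ^ j) (Z.α t) → Q.opMk q (arr K γ) • Fa t j = 0
  b_zero : ∀ s j γ, 0 < j → j < Z.lb s → γ ≠ (Q.σ ^ j) (Z.β s) → Q.opMk q (arr K γ) • Fb s j = 0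
  socle_zero : ∀ s γ, Q.opMk q (arr K γ) • Fb s (Z.lb s) = 0

/-- The linear map given on the basis of points is equivariant as soon as it commutes with the
generators on that basis, which is what the fields of `IsZigzag` say. -/
lemma IsZigzag.exists_hom {Fa Fb : ι → ℕ → X} (hF : IsZigzag Z q Fa Fb) :
    ∃ f : Mod h →ₗ[(Q.Alg q)ᵐᵒᵖ] X, (∀ t j, j ≤ Z.la t → f (amod h t j) = Fa t j) ∧
      ∀ s j, j ≤ Z.lb s → f (bmod h s j) = Fb s j := by
  let f : Mod h →ₗ[K] X := (basis h).constr K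
    (Sum.elim (fun y => Fa y.1 y.2) fun y => Fb y.1 (y.2 + 1))
  have ha' : ∀ t j, j < Z.la t → f (amod h t j) = Fa t j := fun t j hj => by
    have := (basis h).constr_basis K
      (Sum.elim (fun y => Fa y.1 y.2) fun y => Fb y.1 (y.2 + 1)) (Sum.inl ⟨t, ⟨j, hj⟩⟩)
    rwa [basis_inl] at this
  have hb : ∀ s j, j ≤ Z.lb s → f (bmod h s j) = Fb s j := fun s j hj => by
    cases j with
    | zero => rw [bmod_zero, ha' _ _ (Z.la_pos _), hF.top]
    | succ n =>
      have := (basis h).constr_basis K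
        (Sum.elim (fun y => Fa y.1 y.2) fun y => Fb y.1 (y.2 + 1)) (Sum.inr ⟨s, ⟨n, hj⟩⟩)
      rwa [basis_inr] at this
  have ha : ∀ t j, j ≤ Z.la t → f (amod h t j) = Fa t j := fun t j hj => by
    rcases hj.lt_or_eq with hj | rfl
    · exact ha' t j hj
    · rw [amod_la, hb _ _ le_rfl, hF.socle]
  have key : ∀ g : FreeAlgebra K (V ⊕ A),
      (∀ t j, j < Z.la t → f (Q.opMk q g • amod h t j) = Q.opMk q g • Fa t j) →
      (∀ s j, 0 < j → j ≤ Z.lb s → f (Q.opMk q g • bmod h s j) = Q.opMk q g • Fb s j) →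
      ∀ y, f (Q.opMk q g • y) = Q.opMk q g • f y := by
    intro g h1 h2 y
    refine LinearMap.congr_fun (f := f ∘ₗ Module.toModuleEnd K (Mod h) (Q.opMk q g))
      (g := Module.toModuleEnd K X (Q.opMk q g) ∘ₗ f) ((basis h).ext fun z => ?_) y
    rcases z with z | z
    · rw [basis_inl]
      change f (Q.opMk q g • amod h _ _) = Q.opMk q g • f (amod h _ _)
      rw [h1 _ _ z.2.2, ha' _ _ z.2.2]
    · rw [basis_inr]
      change f (Q.opMk q g • bmod h _ _) = Q.opMk q g • f (bmod h _ _)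
      rw [h2 _ _ (Nat.succ_pos _) z.2.2, hb _ _ z.2.2]
  have hs : ∀ (r : (Q.Alg q)ᵐᵒᵖ) (y : Mod h), f (r • y) = r • f y :=
    map_smul_of_generators f (fun i => key _ ?_ ?_) fun γ => key _ ?_ ?_
  · exact ⟨{ toFun := f, map_add' := map_add f, map_smul' := hs }, ha, hb⟩
  · intro t j hj
    by_cases hi : Q.src ((Q.σ ^ j) (Z.α t)) = i
    · rw [← hi, amod_vert, hF.a_vert t j hj, ha' t j hj]
    · rw [opMk_vert_vert_smul hi (amod_vert h t j), opMk_vert_vert_smul hi (hF.a_vert t j hj), map_zero]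
  · intro s j h0 hj
    by_cases hi : Q.src ((Q.σ ^ j) (Z.β s)) = i
    · rw [← hi, bmod_vert, hF.b_vert s j h0 hj, hb s j hj]
    · rw [opMk_vert_vert_smul hi (bmod_vert h s j), opMk_vert_vert_smul hi (hF.b_vert s j h0 hj),
        map_zero]
  · intro t j hj
    by_cases hγ : γ = (Q.σ ^ j) (Z.α t)
    · rw [hγ, amod_step, map_smul, hF.a_step t j hj, ha _ _ hj]
    rcases Nat.eq_zero_or_pos j with rfl | h0
    -- A top has a second outgoing arrow, visible only when the top is read as the start of the path
    -- of `β s`.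
    · by_cases hγ' : ∃ s, Z.nx s = t ∧ γ = Z.β s
      · obtain ⟨s, rfl, rfl⟩ := hγ'
        have h1 := bmod_step h s 0
        have h2 := hF.b_step s 0 (Z.lb_pos s)
        simp only [pow_zero, Equiv.Perm.one_apply] at h1 h2
        rw [← bmod_zero, h1, map_smul, ← hF.top, h2, hb _ _ (Z.lb_pos s)]
      · push Not at hγ'
        rw [amod_zero_smul_eq_zero h hγ hγ', hF.top_zero t γ hγ hγ', map_zero]
    · rw [amod_smul_eq_zero h h0 hγ, hF.a_zero t j γ h0 hj hγ, map_zero]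
  · intro s j h0 hj
    rcases hj.lt_or_eq with hj | rfl
    · by_cases hγ : γ = (Q.σ ^ j) (Z.β s)
      · rw [hγ, bmod_step, map_smul, hF.b_step s j hj, hb _ _ hj]
      · rw [bmod_smul_eq_zero h h0 hγ, hF.b_zero s j γ h0 hj hγ, map_zero]
    · rw [bmod_lb_smul, hF.socle_zero, map_zero]

end Zigzag
end SpecialBiserial

/-! ### Bases, depth and superfluous submodules -/

namespace SpecialBiserial

variable {V A : Type v} [Fintype V] [Fintype A] {Q : SpecialBiserial V A} {K : Type u} [Field K]

namespace Zigzag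

variable {ι : Type} [Fintype ι] [DecidableEq ι] {Z : Zigzag Q K ι} {q : A → Kˣ}
variable (h : Z.Admissible q)

lemma exists_linearMap {X : Type*} [AddCommGroup X] [Module K X] (Ga Gb : ι → ℕ → X) :
    ∃ f : Mod h →ₗ[K] X, (∀ t j, j < Z.la t → f (amod h t j) = Ga t j) ∧
      ∀ s j, 0 < j → j ≤ Z.lb s → f (bmod h s j) = Gb s j := by
  refine ⟨(basis h).constr K (Sum.elim (fun y => Ga y.1 y.2) fun y => Gb y.1 (y.2 + 1)), ?_, ?_⟩
  · intro t j hj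
    have := (basis h).constr_basis K
      (Sum.elim (fun y => Ga y.1 y.2) fun y => Gb y.1 (y.2 + 1)) (Sum.inl ⟨t, ⟨j, hj⟩⟩)
    rwa [basis_inl] at this
  · intro s j h0 hj
    obtain ⟨n, rfl⟩ : ∃ n, j = n + 1 := ⟨j - 1, by omega⟩
    have := (basis h).constr_basis K
      (Sum.elim (fun y => Ga y.1 y.2) fun y => Gb y.1 (y.2 + 1)) (Sum.inr ⟨s, ⟨n, hj⟩⟩)
    rwa [basis_inr] at this

lemma induction_points {P : Mod h → Prop} (hadd : ∀ x y, P x → P y → P (x + y)) (h0 : P 0)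
    (hsmul : ∀ (c : K) x, P x → P (c • x)) (ha : ∀ t j, j < Z.la t → P (amod h t j))
    (hb : ∀ s j, 0 < j → j ≤ Z.lb s → P (bmod h s j)) (x : Mod h) : P x := by
  rw [← (basis h).sum_repr x]
  refine Finset.sum_induction _ P hadd h0 fun z _ => hsmul _ _ ?_
  rcases z with z | z
  · rw [basis_inl]
    exact ha _ _ z.2.2
  · rw [basis_inr]
    exact hb _ _ (Nat.succ_pos _) z.2.2

/-- A rank function on points that increases along arrows and vanishes exactly on tops. -/
def depth (Z : Zigzag Q K ι) : Z.Pt → ℕ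
  | Sum.inl ⟨_, j⟩ => j
  | Sum.inr ⟨_, j⟩ => ∑ t, Z.la t + j + 1

lemma depth_start_lt (s : Z.Pt) : Z.depth (Z.start s) < Z.depth (Z.finish s) := by
  rcases s with ⟨t, ⟨j, hj⟩⟩ | ⟨t, ⟨j, hj⟩⟩
  · have : Z.la t ≤ ∑ t, Z.la t := Finset.single_le_sum (fun _ _ => Nat.zero_le _)
      (Finset.mem_univ t)
    by_cases h : j + 1 < Z.la t
    · simp [start, finish, h, depth]
    · simp only [start, finish, h, depth, dite_false]
      omega
  · cases j with
    | zero => simp [start, finish, depth]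
    | succ n => simp [start, finish, depth]

/-- Vectors that vanish at all points of depth less than `n`. -/
def deep (n : ℕ) : Submodule K (Mod h) where
  carrier := {x | ∀ p, Z.depth p < n → (x : Z.Pt → K) p = 0}
  add_mem' hx hy p hp := (congrArg₂ (· + ·) (hx p hp) (hy p hp)).trans (add_zero 0)
  zero_mem' _ _ := rfl
  smul_mem' c _ hx p hp := (congrArg (c * ·) (hx p hp)).trans (mul_zero c)

lemma arr_smul_mem_deep {n : ℕ} {x : Mod h} (hx : x ∈ deep h n) (γ : A) :
    Q.opMk q (arr K γ) • x ∈ deep h (n + 1) := by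
  intro p hp
  rw [opMk_arr_smul_eq]
  by_cases hs : ∃ s, Z.finish s = p ∧ Z.label s = γ
  · obtain ⟨s, rfl, rfl⟩ := hs
    have := Z.depth_start_lt s
    exact (Z.vecMul_finish x s).trans ((congrArg _ (hx _ (by omega))).trans (mul_zero _))
  · by_contra hn
    obtain ⟨y, -, hy⟩ := Finset.exists_ne_zero_of_sum_ne_zero hn
    obtain ⟨s, h1, -, h2⟩ := Z.exists_step (right_ne_zero_of_mul hy)
    exact hs ⟨s, h2, h1⟩

lemma basis_apply (p : Z.Pt) : basis h p = (Pi.single p 1 : Z.Pt → K) := Pi.basisFun_apply _ _ _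

lemma basis_finish (s : Z.Pt) : basis h (Z.finish s) =
    (Z.weight s)⁻¹ • Q.opMk q (arr K (Z.label s)) • basis h (Z.start s) := by
  have h1 : Q.opMk q (arr K (Z.label s)) • basis h (Z.start s) =
      Z.weight s • basis h (Z.finish s) := by
    rw [opMk_arr_smul_eq, basis_apply, basis_apply]
    exact Z.single_start_vecMul s
  rw [h1, smul_smul, inv_mul_cancel₀ (Z.weight_ne_zero s), one_smul]

/-- Nakayama's lemma by hand: elements with no top coordinate lie in the radical, and `S`
approximates every element to greater and greater depth, which is bounded. -/
lemma isSuperfluous_of_top_eq_zero (N : Submodule (Q.Alg q)ᵐᵒᵖ (Mod h))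
    (hN : ∀ x ∈ N, ∀ t, (x : Z.Pt → K) (Sum.inl ⟨t, ⟨0, Z.la_pos t⟩⟩) = 0) :
    IsSuperfluous N := by
  intro S hS
  have h1 : ∀ x : Mod h, ∃ s ∈ S, x - s ∈ deep h 1 := by
    intro x
    have hx : x ∈ N ⊔ S := hS ▸ Submodule.mem_top
    obtain ⟨y, hy, s, hs, rfl⟩ := Submodule.mem_sup.1 hx
    refine ⟨s, hs, ?_⟩
    rw [add_sub_cancel_right]
    intro p hp
    rcases p with ⟨t, ⟨j, hj⟩⟩ | ⟨t, j⟩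
    · obtain rfl : j = 0 := by simpa [depth] using hp
      exact hN y hy t
    · simp [depth] at hp
  have h2 : ∀ n, ∀ x : Mod h, ∃ s ∈ S, x - s ∈ deep h (n + 1) := by
    intro n
    induction n with
    | zero => exact h1
    | succ n ih =>
      intro x
      obtain ⟨s, hs, hx⟩ := h1 x
      suffices hq : ∃ s' ∈ S, x - s - s' ∈ deep h (n + 2) by
        obtain ⟨s', hs', hx'⟩ := hq
        exact ⟨s + s', S.add_mem hs hs', by rwa [← sub_sub]⟩
      have hp : ∀ p, ∃ s' ∈ S, ((basis h).repr (x - s) p) • basis h p - s' ∈ deep h (n + 2) := by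
        intro p
        by_cases hp : ∃ t, p = Sum.inl ⟨t, ⟨0, Z.la_pos t⟩⟩
        · obtain ⟨t, rfl⟩ := hp
          have h0 : (basis h).repr (x - s) (Sum.inl ⟨t, ⟨0, Z.la_pos t⟩⟩) = 0 :=
            (Pi.basisFun_repr _ _ _ _).trans (hx _ (by simp [depth]))
          exact ⟨0, S.zero_mem, by rw [h0, zero_smul, sub_zero]; exact Submodule.zero_mem _⟩
        · push Not at hp
          obtain ⟨σ, rfl⟩ := Z.exists_finish_eq p hp
          -- A point that is not a top is the image of the start of a step; approximating that start
          -- in `S` and applying the arrow gains one level of depth.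
          obtain ⟨s', hs', hd⟩ := ih (basis h (Z.start σ))
          refine ⟨((basis h).repr (x - s) (Z.finish σ)) • (Z.weight σ)⁻¹ •
            Q.opMk q (arr K (Z.label σ)) • s', ?_, ?_⟩
          · exact (S.restrictScalars K).smul_mem _ ((S.restrictScalars K).smul_mem _
              (S.smul_mem _ hs'))
          · rw [basis_finish, ← smul_sub, ← smul_sub, ← smul_sub]
            exact Submodule.smul_mem _ _ (Submodule.smul_mem _ _ (arr_smul_mem_deep h hd _))
      choose f hf hf' using hp
      refine ⟨∑ p, f p, S.sum_mem fun p _ => hf p, ?_⟩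
      have := Submodule.sum_mem _ fun p (_ : p ∈ Finset.univ) => hf' p
      rwa [Finset.sum_sub_distrib, (basis h).sum_repr (x - s)] at this
  refine eq_top_iff.2 fun x _ => ?_
  obtain ⟨s, hs, hx⟩ := h2 (∑ p, Z.depth p) x
  have : x - s = 0 := funext fun p => hx p (Nat.lt_succ_of_le
    (Finset.single_le_sum (fun _ _ => Nat.zero_le _) (Finset.mem_univ p)))
  rwa [sub_eq_zero.1 this]

end Zigzag

/-! ### Paths as elements of the algebra -/

section Paths

variable {q : A → Kˣ}

variable (Q) in
/-- The initial subpath of length `j` of the closed path starting with `α`, in the opposite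
algebra of `Λ_q`. -/
def opPath (q : A → Kˣ) (α : A) (j : ℕ) : (Q.Alg q)ᵐᵒᵖ :=
  Q.opMk q (vert K (Q.src α) * Q.run K α j)

lemma opPath_zero (α : A) : Q.opPath q α 0 = Q.opMk q (vert K (Q.src α)) := by
  rw [opPath, run_zero, mul_one]

lemma opPath_succ (α : A) (j : ℕ) :
    Q.opPath q α (j + 1) = Q.opMk q (arr K ((Q.σ ^ j) α)) * Q.opPath q α j := by
  rw [opPath, opPath, run_succ, ← opMk_mul, mul_assoc]

lemma opPath_vert (α : A) (j : ℕ) :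
    Q.opMk q (vert K (Q.src ((Q.σ ^ j) α))) * Q.opPath q α j = Q.opPath q α j := by
  cases j with
  | zero =>
    rw [opPath_zero, ← opMk_mul]
    exact opMk_eq_of_rel (Rel.idem _)
  | succ n => rw [opPath_succ, ← mul_assoc, ← opMk_mul, src_pow_succ,
      opMk_eq_of_rel (Rel.mul_tgt _)]

lemma opPath_zero_zero {α γ : A} (hγ : Q.src α ≠ Q.src γ) :
    Q.opMk q (arr K γ) * Q.opPath q α 0 = 0 := by
  exact opMk_arr_smul_eq_zero (q := q) (x := Q.opPath q α 0) hγ (opPath_vert α 0)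

lemma opPath_zero_of_ne {α γ : A} {j : ℕ} (hj : 0 < j) (hγ : γ ≠ (Q.σ ^ j) α) :
    Q.opMk q (arr K γ) * Q.opPath q α j = 0 := by
  by_cases hs : Q.src ((Q.σ ^ j) α) = Q.src γ
  · obtain ⟨n, rfl⟩ : ∃ n, j = n + 1 := ⟨j - 1, by omega⟩
    rw [src_pow_succ] at hs
    rw [pow_succ_apply] at hγ
    rw [opPath_succ, ← mul_assoc, ← opMk_mul, opMk_eq_of_rel (Rel.zero _ _ hs hγ), opMk_zero,
      zero_mul]
  · exact opMk_arr_smul_eq_zero (q := q) (x := Q.opPath q α j) hs (opPath_vert α j)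

lemma opPath_socle {α β : A} (hs : Q.src α = Q.src β) (hne : α ≠ β) :
    (q α : K) • Q.opPath q α (Q.len α) + (q β : K) • Q.opPath q β (Q.len β) = 0 := by
  rw [opPath, opPath, ← hs, ← cyc_eq_run, ← cyc_eq_run, opMk_mul, opMk_mul, ← smul_mul_assoc,
    ← smul_mul_assoc, ← add_mul, ← opMk_smul, ← opMk_smul, ← opMk_add,
    opMk_eq_of_rel (Rel.socle_two α β hs hne), opMk_zero, zero_mul]

end Paths

/-! ### Bands, their complements, and scalars -/

/-- The shape of a band: a zigzag of proper initial subpaths of the closed paths of the socle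
relations, without scalars. -/
@[ext]
structure Band (Q : SpecialBiserial V A) (ι : Type) where
  α : ι → A
  β : ι → A
  la : ι → ℕ
  lb : ι → ℕ
  la_pos : ∀ t, 0 < la t
  lb_pos : ∀ s, 0 < lb s
  la_lt : ∀ t, la t < Q.len (α t)
  lb_lt : ∀ s, lb s < Q.len (β s)
  nx : Equiv.Perm ι
  τ : Equiv.Perm ι
  src_head : ∀ s, Q.src (β s) = Q.src (α (nx s))
  head_ne : ∀ s, β s ≠ α (nx s)
  src_end : ∀ t, Q.src ((Q.σ ^ lb (τ t)) (β (τ t))) = Q.src ((Q.σ ^ la t) (α t))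
  end_ne : ∀ t, (Q.σ ^ lb (τ t)) (β (τ t)) ≠ (Q.σ ^ la t) (α t)

namespace Band

variable {ι : Type} (B : Band Q ι)

lemma pow_sub_len {γ : A} {l : ℕ} (hl : l < Q.len γ) :
    (Q.σ ^ (Q.len ((Q.σ ^ l) γ) - l)) ((Q.σ ^ l) γ) = γ := by
  rw [BandWord.len_pow, ← Equiv.Perm.mul_apply, ← pow_add, Nat.sub_add_cancel hl.le,
    Q.pow_len_apply]

/-- The shape of the syzygies of the band modules of shape `B`, given by the complements of the
paths of `B` in the closed paths of the socle relations. -/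
def Ω : Band Q ι where
  α t := (Q.σ ^ B.la t) (B.α t)
  β s := (Q.σ ^ B.lb s) (B.β s)
  la t := Q.len ((Q.σ ^ B.la t) (B.α t)) - B.la t
  lb s := Q.len ((Q.σ ^ B.lb s) (B.β s)) - B.lb s
  la_pos t := by
    rw [BandWord.len_pow]
    exact Nat.sub_pos_of_lt (B.la_lt t)
  lb_pos t := by
    rw [BandWord.len_pow]
    exact Nat.sub_pos_of_lt (B.lb_lt t)
  la_lt t := by
    have := B.la_pos t
    have := B.la_lt t
    rw [BandWord.len_pow]
    omega
  lb_lt t := by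
    have := B.lb_pos t
    have := B.lb_lt t
    rw [BandWord.len_pow]
    omega
  -- The common ends of the paths of `B` become the tops, and the tops of `B` become the socle
  -- positions.
  nx := B.τ.symm
  τ := B.nx.symm
  src_head s := by
    have := B.src_end (B.τ.symm s)
    rwa [Equiv.apply_symm_apply] at this
  head_ne s := by
    have := B.end_ne (B.τ.symm s)
    rwa [Equiv.apply_symm_apply] at this
  src_end t := by
    rw [pow_sub_len (B.la_lt _), pow_sub_len (B.lb_lt _), B.src_head, Equiv.apply_symm_apply]
  end_ne t := by
    rw [pow_sub_len (B.la_lt _), pow_sub_len (B.lb_lt _)]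
    have := B.head_ne (B.nx.symm t)
    rwa [Equiv.apply_symm_apply] at this

lemma Ω_Ω : B.Ω.Ω = B := by
  refine Band.ext ?_ ?_ ?_ ?_ rfl rfl
  · exact funext fun t => pow_sub_len (B.la_lt t)
  · exact funext fun t => pow_sub_len (B.lb_lt t)
  · funext t
    have := B.la_lt t
    simp only [Ω, BandWord.len_pow]
    omega
  · funext t
    have := B.lb_lt t
    simp only [Ω, BandWord.len_pow]
    omega

/-- The zigzag of the band module with scalar `ω t` at the first arrow of the path of `α t`. -/
def zigzag (ω : ι → Kˣ) : Zigzag Q K ι where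
  α := B.α
  β := B.β
  la := B.la
  lb := B.lb
  la_pos := B.la_pos
  lb_pos := B.lb_pos
  nx := B.nx
  τ := B.τ
  src_head := B.src_head
  head_ne := B.head_ne
  src_end := B.src_end
  end_ne := B.end_ne
  wa t j := if j = 0 then ω t else 1
  wb _ _ := 1

/-- The zigzag of the projective cover of a band module. -/
def cover (ω ρ : ι → Kˣ) : Zigzag Q K ι where
  α := B.α
  β := B.β
  la t := Q.len (B.α t)
  lb s := Q.len (B.β s)
  la_pos t := Zigzag.len_pos _
  lb_pos s := Zigzag.len_pos _
  nx := B.nx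
  -- Paths with a common start also have a common end, so this zigzag is a disjoint union of
  -- diamonds.
  τ := B.nx.symm
  src_head := B.src_head
  head_ne := B.head_ne
  src_end t := by
    rw [Q.pow_len_apply, Q.pow_len_apply, B.src_head, Equiv.apply_symm_apply]
  end_ne t := by
    rw [Q.pow_len_apply, Q.pow_len_apply]
    have := B.head_ne (B.nx.symm t)
    rwa [Equiv.apply_symm_apply] at this
  wa t j := if j = 0 then ω t else 1
  -- The correcting scalar sits on the first step beyond the path of the band. The projection kills
  -- the end of that step, so the weights inside the band are unaffected.
  wb s j := if j = B.lb s then ρ s else 1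

/-- The scalars for the projective cover that match the socle relations. -/
def ρ (q : A → Kˣ) (ω : ι → Kˣ) (s : ι) : Kˣ := -(q (B.α (B.nx s)) * ω (B.nx s) / q (B.β s))

/-- The scalars of the syzygy. -/
def Ωscalar (q : A → Kˣ) (ω : ι → Kˣ) (t : ι) : Kˣ := -(B.ρ q ω (B.τ t))⁻¹

variable [Fintype ι] [DecidableEq ι] (q : A → Kˣ) (ω : ι → Kˣ)

/-- Proper subpaths make both terms of each socle relation vanish, so any scalars and any `q` are
allowed. -/
lemma zigzag_admissible : (B.zigzag ω).Admissible q where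
  la_le t := (B.la_lt t).le
  lb_le t := (B.lb_lt t).le
  socle s := by
    rw [Zigzag.av_eq_zero _ (B.la_lt _), Zigzag.bv_eq_zero _ (B.lb_lt _)]
    simp

/-- Both closed paths reach the same socle point, with scalars `ω` and `ρ`; the definition of `ρ`
makes the two terms cancel. -/
lemma cover_admissible : (B.cover ω (B.ρ q ω)).Admissible q where
  la_le t := le_rfl
  lb_le t := le_rfl
  socle s := by
    have h1 : (B.cover ω (B.ρ q ω)).av (B.nx s) (Q.len (B.α (B.nx s))) =
        (B.cover ω (B.ρ q ω)).bv s (Q.len (B.β s)) := by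
      have := (B.cover ω (B.ρ q ω)).av_la (B.nx s)
      change _ = (B.cover ω (B.ρ q ω)).bv (B.nx.symm (B.nx s))
        (Q.len (B.β (B.nx.symm (B.nx s)))) at this
      rw [Equiv.symm_apply_apply] at this
      exact this
    have h2 : ∏ i ∈ Finset.range (Q.len (B.α (B.nx s))),
        ((if i = 0 then ω (B.nx s) else 1 : Kˣ) : K) = ω (B.nx s) := by
      rw [← Units.coe_prod, Finset.prod_ite_eq', if_pos (Finset.mem_range.2 (Zigzag.len_pos _))]
    have h3 : ∏ i ∈ Finset.range (Q.len (B.β s)),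
        ((if i = B.lb s then B.ρ q ω s else 1 : Kˣ) : K) = B.ρ q ω s := by
      rw [← Units.coe_prod, Finset.prod_ite_eq', if_pos (Finset.mem_range.2 (B.lb_lt s))]
    change (q (B.α (B.nx s)) : K) • ((∏ i ∈ Finset.range (Q.len (B.α (B.nx s))),
        ((if i = 0 then ω (B.nx s) else 1 : Kˣ) : K)) • (B.cover ω (B.ρ q ω)).av (B.nx s)
          (Q.len (B.α (B.nx s)))) + (q (B.β s) : K) • ((∏ i ∈ Finset.range (Q.len (B.β s)),
        ((if i = B.lb s then B.ρ q ω s else 1 : Kˣ) : K)) • (B.cover ω (B.ρ q ω)).bv s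
          (Q.len (B.β s))) = 0
    rw [h1, h2, h3, smul_smul, smul_smul, ← add_smul]
    convert zero_smul K _
    simp only [ρ, Units.val_neg, Units.val_div_eq_div_val, Units.val_mul]
    field_simp
    ring

end Band
end SpecialBiserial

/-! ### The syzygy of a band module -/

namespace SpecialBiserial

variable {V A : Type v} [Fintype V] [Fintype A] {Q : SpecialBiserial V A} {K : Type u} [Field K]

namespace Zigzag

variable {ι : Type} [Fintype ι] [DecidableEq ι] {Z : Zigzag Q K ι} {q : A → Kˣ}
variable (h : Z.Admissible q)

lemma bmod_apply_top {s : ι} {j : ℕ} (hj : 0 < j) (t : ι) :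
    (bmod h s j : Z.Pt → K) (Sum.inl ⟨t, ⟨0, Z.la_pos t⟩⟩) = 0 := by
  obtain ⟨n, rfl⟩ : ∃ n, j = n + 1 := ⟨j - 1, by omega⟩
  change Z.bv s (n + 1) _ = 0
  by_cases hn : n < Z.lb s
  · rw [Z.bv_succ hn, Pi.single_apply, if_neg (by simp)]
  · rw [Z.bv_eq_zero (by omega), Pi.zero_apply]

lemma amod_apply_top {t' : ι} {j : ℕ} (hj : 0 < j) (t : ι) :
    (amod h t' j : Z.Pt → K) (Sum.inl ⟨t, ⟨0, Z.la_pos t⟩⟩) = 0 := by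
  rcases lt_trichotomy j (Z.la t') with h' | rfl | h'
  · change Z.av t' j _ = 0
    rw [Z.av_of_lt h', Pi.single_apply, if_neg]
    simp only [Sum.inl.injEq, Sigma.mk.injEq, not_and]
    rintro rfl
    simp only [heq_eq_eq, Fin.mk.injEq]
    omega
  · rw [amod_la]
    exact bmod_apply_top h (Z.lb_pos _) t
  · rw [amod_eq_zero h h']
    rfl

end Zigzag

namespace Band

variable {ι : Type} [Fintype ι] [DecidableEq ι] (B : Band Q ι) (q : A → Kˣ) (ω : ι → Kˣ)

open Zigzag

/-- The band module of shape `B` with scalars `ω`. -/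
abbrev M : Type u := Mod (B.zigzag_admissible q ω)

/-- Its projective cover. -/
abbrev Cover : Type u := Mod (B.cover_admissible q ω)

abbrev Ma (t : ι) (j : ℕ) : B.M q ω := amod (B.zigzag_admissible q ω) t j

abbrev Mb (s : ι) (j : ℕ) : B.M q ω := bmod (B.zigzag_admissible q ω) s j

abbrev Ca (t : ι) (j : ℕ) : B.Cover q ω := amod (B.cover_admissible q ω) t j

abbrev Cb (s : ι) (j : ℕ) : B.Cover q ω := bmod (B.cover_admissible q ω) s j

lemma opPath_socle_eq (s : ι) :
    ((ω (B.nx s))⁻¹ : Kˣ) • Q.opPath q (B.α (B.nx s)) (Q.len (B.α (B.nx s))) =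
      ((B.ρ q ω s)⁻¹ : Kˣ) • Q.opPath q (B.β s) (Q.len (B.β s)) := by
  have h := opPath_socle (q := q) (B.src_head s).symm (B.head_ne s).symm
  have h' : (q (B.α (B.nx s)) : K) • ((ω (B.nx s) * (B.ρ q ω s)⁻¹ : Kˣ) : K) •
      Q.opPath q (B.β s) (Q.len (B.β s)) +
      (q (B.β s) : K) • Q.opPath q (B.β s) (Q.len (B.β s)) = 0 := by
    rw [smul_smul, ← add_smul]
    refine (congrArg (· • _) ?_).trans (zero_smul K _)
    simp only [ρ, Units.val_neg, Units.val_div_eq_div_val, Units.val_mul, Units.val_inv_eq_inv_val]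
    field_simp
    ring
  have h2 := add_right_cancel (h.trans h'.symm)
  rw [← Units.smul_def, ← Units.smul_def, ← Units.smul_def] at h2
  rw [(MulAction.injective _) h2, mul_smul, inv_smul_smul]

/-- The points of the projective cover, as elements of a free module. -/
lemma cover_isZigzag : IsZigzag (B.cover ω (B.ρ q ω)) q
    (fun t j => (if j = 0 then 1 else (ω t)⁻¹ : Kˣ) •
      (Pi.single t (Q.opPath q (B.α t) j) : ι → (Q.Alg q)ᵐᵒᵖ))
    (fun s j => (if j ≤ B.lb s then 1 else (B.ρ q ω s)⁻¹ : Kˣ) •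
      (Pi.single (B.nx s) (Q.opPath q (B.β s) j) : ι → (Q.Alg q)ᵐᵒᵖ)) := by
  -- The inverse scalars undo the weights of the cover, and with them the socle relation becomes an
  -- equality of the two ends.
  have hsoc : ∀ s, (if Q.len (B.α (B.nx s)) = 0 then 1 else (ω (B.nx s))⁻¹ : Kˣ) •
      (Pi.single (B.nx s) (Q.opPath q (B.α (B.nx s)) (Q.len (B.α (B.nx s)))) :
        ι → (Q.Alg q)ᵐᵒᵖ) =
      (if Q.len (B.β s) ≤ B.lb s then 1 else (B.ρ q ω s)⁻¹ : Kˣ) •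
      (Pi.single (B.nx s) (Q.opPath q (B.β s) (Q.len (B.β s))) : ι → (Q.Alg q)ᵐᵒᵖ) := by
    intro s
    rw [if_neg (Zigzag.len_pos _).ne', if_neg (B.lb_lt s).not_ge, ← Pi.single_smul,
      ← Pi.single_smul, opPath_socle_eq]
  have hsm : ∀ (c : Kˣ) (t : ι) (r r' : (Q.Alg q)ᵐᵒᵖ),
      r • c • (Pi.single t r' : ι → (Q.Alg q)ᵐᵒᵖ) = c • Pi.single t (r * r') := by
    intro c t r r'
    rw [Units.smul_def, Units.smul_def, smul_comm, ← Pi.single_smul, smul_eq_mul]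
  refine ⟨fun s => ?_, fun t => ?_, fun t j hj => ?_, fun s j hj => ?_, fun t j hj => ?_,
    fun s j h0 hj => ?_, fun t γ h1 h2 => ?_, fun t j γ h0 hj hγ => ?_, fun s j γ h0 hj hγ => ?_,
    fun s γ => ?_⟩
  · change _ = (if 0 = 0 then 1 else _ : Kˣ) •
      (Pi.single (B.nx s) (Q.opPath q (B.α (B.nx s)) 0) : ι → (Q.Alg q)ᵐᵒᵖ)
    rw [if_pos (Nat.zero_le _), if_pos rfl, opPath_zero, opPath_zero, B.src_head]
  · have := hsoc (B.nx.symm t)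
    rw [Equiv.apply_symm_apply] at this
    refine this.trans ?_
    change _ = (if Q.len (B.β (B.nx.symm t)) ≤ B.lb (B.nx.symm t) then 1 else _ : Kˣ) •
      (Pi.single (B.nx (B.nx.symm t)) (Q.opPath q (B.β (B.nx.symm t))
        (Q.len (B.β (B.nx.symm t)))) : ι → (Q.Alg q)ᵐᵒᵖ)
    rw [Equiv.apply_symm_apply]
    rfl
  · rw [hsm, ← Units.smul_def, smul_smul]
    change _ • (Pi.single _ (Q.opMk q (arr K ((Q.σ ^ j) (B.α t))) * Q.opPath q (B.α t) j) :
      ι → (Q.Alg q)ᵐᵒᵖ) = _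
    rw [← opPath_succ]
    congr 1
    change _ = (if j = 0 then ω t else 1) * _
    by_cases h : j = 0 <;> simp [h]
  · rw [hsm, ← Units.smul_def, smul_smul]
    change _ • (Pi.single _ (Q.opMk q (arr K ((Q.σ ^ j) (B.β s))) * Q.opPath q (B.β s) j) :
      ι → (Q.Alg q)ᵐᵒᵖ) = _
    rw [← opPath_succ]
    congr 1
    change _ = (if j = B.lb s then B.ρ q ω s else 1) * _
    rcases lt_trichotomy j (B.lb s) with h | rfl | h
    · rw [if_pos h.le, if_neg h.ne, if_pos (Nat.succ_le_of_lt h), one_mul]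
    · simp
    · rw [if_neg (by omega), if_neg h.ne', if_neg (by omega), one_mul]
  · rw [hsm]
    congr 2
    exact opPath_vert _ _
  · rw [hsm]
    congr 2
    exact opPath_vert _ _
  · rw [hsm]
    have : Q.opMk q (arr K γ) * Q.opPath q (B.α t) 0 = 0 := by
      refine opPath_zero_zero fun hs => ?_
      have h3 := B.src_head (B.nx.symm t)
      have h4 := B.head_ne (B.nx.symm t)
      rw [Equiv.apply_symm_apply] at h3 h4
      rcases Q.eq_or_eq_of_src_eq h4.symm h3 hs.symm with h | h
      · exact h1 h
      · exact h2 (B.nx.symm t) (B.nx.apply_symm_apply t) h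
    rw [this, Pi.single_zero, smul_zero]
  · rw [hsm]
    refine (congrArg _ (congrArg _ (opPath_zero_of_ne h0 hγ))).trans ?_
    rw [Pi.single_zero, smul_zero]
  · rw [hsm]
    refine (congrArg _ (congrArg _ (opPath_zero_of_ne h0 hγ))).trans ?_
    rw [Pi.single_zero, smul_zero]
  · change Q.opMk q (arr K γ) • (if Q.len (B.β s) ≤ B.lb s then 1 else _ : Kˣ) •
      (Pi.single (B.nx s) (Q.opPath q (B.β s) (Q.len (B.β s))) : ι → (Q.Alg q)ᵐᵒᵖ) = 0
    -- If `γ` continues the closed path of `β s`, that path is traded in the socle for the closed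
    -- path of the other arrow, which `γ` does not continue.
    by_cases hγ : γ = B.β s
    · rw [← hsoc, hsm, opPath_zero_of_ne (Zigzag.len_pos _), Pi.single_zero, smul_zero]
      rw [Q.pow_len_apply, hγ]
      exact B.head_ne s
    · rw [hsm, opPath_zero_of_ne (Zigzag.len_pos _), Pi.single_zero, smul_zero]
      rwa [Q.pow_len_apply]

/-- The cover is a retract of a free module: points go to rescaled paths, and the retraction sends
the free generators to the tops. -/
instance projective_cover : Module.Projective (Q.Alg q)ᵐᵒᵖ (B.Cover q ω) := by
  obtain ⟨f, hfa, hfb⟩ := (B.cover_isZigzag q ω).exists_hom (B.cover_admissible q ω)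
  refine Module.Projective.of_split f
    (Fintype.linearCombination (Q.Alg q)ᵐᵒᵖ fun t => B.Ca q ω t 0) (LinearMap.ext fun x => ?_)
  have hp : ∀ (c : Kˣ) (t : ι) (r : (Q.Alg q)ᵐᵒᵖ),
      Fintype.linearCombination (Q.Alg q)ᵐᵒᵖ (fun t => B.Ca q ω t 0) (c • Pi.single t r) =
      (c : K) • r • B.Ca q ω t 0 := by
    intro c t r
    rw [Units.smul_def, ← Pi.single_smul, Fintype.linearCombination_apply_single, smul_assoc]
  have hpath : ∀ (α : A) (j : ℕ) (x : B.Cover q ω), Q.opMk q (vert K (Q.src α)) • x = x →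
      Q.opPath q α j • x = Q.opMk q (Q.run K α j) • x := by
    intro α j x hx
    rw [opPath, opMk_mul, mul_smul, hx]
  refine induction_points (B.cover_admissible q ω) (P := fun x => _ = LinearMap.id x) ?_ ?_ ?_
    ?_ ?_ x
  · intro x y hx hy
    rw [map_add, hx, hy, map_add]
  · rw [map_zero, map_zero]
  · intro c x hx
    rw [← algebraMap_smul (Q.Alg q)ᵐᵒᵖ c x, map_smul, hx, map_smul]
  · intro t j hj
    rw [LinearMap.comp_apply, hfa t j hj.le, hp, hpath]
    · refine (congrArg _ (amod_run (B.cover_admissible q ω) t j)).trans ?_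
      rw [smul_smul]
      refine (congrArg (· • _) ?_).trans (one_smul K _)
      change _ * ∏ i ∈ Finset.range j, ((if i = 0 then ω t else 1 : Kˣ) : K) = 1
      rw [← Units.coe_prod, Finset.prod_ite_eq']
      cases j <;> simp
    · exact amod_vert (B.cover_admissible q ω) t 0
  · intro s j h0 hj
    rw [LinearMap.comp_apply, hfb s j hj, hp]
    have h1 : B.Ca q ω (B.nx s) 0 = B.Cb q ω s 0 := (bmod_zero _ _).symm
    rw [h1, hpath]
    · refine (congrArg _ (bmod_run (B.cover_admissible q ω) s j)).trans ?_
      rw [smul_smul]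
      refine (congrArg (· • _) ?_).trans (one_smul K _)
      change _ * ∏ i ∈ Finset.range j, ((if i = B.lb s then B.ρ q ω s else 1 : Kˣ) : K) = 1
      rw [← Units.coe_prod, Finset.prod_ite_eq']
      by_cases h : j ≤ B.lb s
      · simp [h]
      · simp [h, not_le.1 h]
    · exact bmod_vert (B.cover_admissible q ω) s 0

/-- Points of the cover go to the points of the band with the same indices, hence to zero past the
end of a path. The weight `ρ` is harmless because it multiplies a zero vector. -/
lemma aug_isZigzag :
    IsZigzag (B.cover ω (B.ρ q ω)) q (fun t j => B.Ma q ω t j) (fun s j => B.Mb q ω s j) := by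
  refine ⟨fun s => bmod_zero _ _, fun t => ?_, fun t j hj => ?_, fun s j hj => ?_, fun t j hj => ?_,
    fun s j h0 hj => ?_, fun t γ h1 h2 => ?_, fun t j γ h0 hj hγ => ?_, fun s j γ h0 hj hγ => ?_,
    fun s γ => ?_⟩
  · exact (amod_eq_zero _ (B.la_lt t)).trans (bmod_eq_zero _ (B.lb_lt _)).symm
  · exact amod_step _ _ _
  · refine (bmod_step _ _ _).trans ?_
    change ((1 : Kˣ) : K) • B.Mb q ω s (j + 1) =
      ((if j = B.lb s then B.ρ q ω s else 1 : Kˣ) : K) • B.Mb q ω s (j + 1)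
    by_cases h : j = B.lb s
    · have : B.Mb q ω s (j + 1) = 0 := bmod_eq_zero _ (Nat.lt_succ_of_le h.ge)
      rw [this, smul_zero, smul_zero]
    · rw [if_neg h]
  · exact amod_vert _ _ _
  · exact bmod_vert _ _ _
  · exact amod_zero_smul_eq_zero _ h1 h2
  · exact amod_smul_eq_zero _ h0 hγ
  · exact bmod_smul_eq_zero _ h0 hγ
  · have : B.Mb q ω s (Q.len (B.β s)) = 0 := bmod_eq_zero _ (B.lb_lt s)
    exact (congrArg _ this).trans (smul_zero _)

lemma pow_pow_apply (α : A) (i j : ℕ) : (Q.σ ^ j) ((Q.σ ^ i) α) = (Q.σ ^ (i + j)) α := by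
  rw [← Equiv.Perm.mul_apply, ← pow_add, add_comm]

lemma Ωscalar_mul_ρ (s : ι) :
    (B.Ωscalar q ω (B.τ.symm s) : K) * (B.ρ q ω s : K) = -1 := by
  simp [Ωscalar]

/-- The new tops are differences of the ends of the two paths that meet in the band, so they lie in
the kernel of the projection. Each of the two outgoing arrows kills one half of such a difference
and carries the other half along its closed path. -/
lemma inc_isZigzag :
    IsZigzag (B.Ω.zigzag (B.Ωscalar q ω)) q
      (fun t j => if j = 0 then
        (B.Ωscalar q ω t : K) • (B.Ca q ω t (B.la t) - B.Cb q ω (B.τ t) (B.lb (B.τ t)))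
        else B.Ca q ω t (B.la t + j))
      (fun s j => if j = 0 then
        (B.Ωscalar q ω (B.τ.symm s) : K) • (B.Ca q ω (B.τ.symm s) (B.la (B.τ.symm s)) -
          B.Cb q ω (B.τ (B.τ.symm s)) (B.lb (B.τ (B.τ.symm s))))
        else B.Cb q ω s (B.lb s + j)) := by
  have hla : ∀ t, B.la t + (Q.len ((Q.σ ^ B.la t) (B.α t)) - B.la t) = Q.len (B.α t) := by
    intro t
    have := B.la_lt t
    rw [BandWord.len_pow]
    omega
  have hlb : ∀ t, B.lb t + (Q.len ((Q.σ ^ B.lb t) (B.β t)) - B.lb t) = Q.len (B.β t) := by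
    intro t
    have := B.lb_lt t
    rw [BandWord.len_pow]
    omega
  refine ⟨fun s => rfl, fun t => ?_, fun t j hj => ?_, fun s j hj => ?_, fun t j hj => ?_,
    fun s j h0 hj => ?_, fun t γ h1 h2 => ?_, fun t j γ h0 hj hγ => ?_, fun s j γ h0 hj hγ => ?_,
    fun s γ => ?_⟩
  · rw [if_neg (Zigzag.la_pos _ _).ne', if_neg (Zigzag.lb_pos _ _).ne']
    change B.Ca q ω t (B.la t + (Q.len ((Q.σ ^ B.la t) (B.α t)) - B.la t)) =
      B.Cb q ω (B.nx.symm t) (B.lb (B.nx.symm t) +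
        (Q.len ((Q.σ ^ B.lb (B.nx.symm t)) (B.β (B.nx.symm t))) - B.lb (B.nx.symm t)))
    rw [hla, hlb]
    exact amod_la (B.cover_admissible q ω) t
  · change Q.opMk q (arr K ((Q.σ ^ j) ((Q.σ ^ B.la t) (B.α t)))) • _ =
      ((if j = 0 then B.Ωscalar q ω t else 1 : Kˣ) : K) • _
    rw [pow_pow_apply]
    have hw : ∀ i, 0 < i → Q.opMk q (arr K ((Q.σ ^ i) (B.α t))) • B.Ca q ω t i =
        B.Ca q ω t (i + 1) := by
      intro i hi
      refine (amod_step (B.cover_admissible q ω) t i).trans ?_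
      change ((if i = 0 then ω t else 1 : Kˣ) : K) • _ = _
      rw [if_neg hi.ne', Units.val_one, one_smul]
    by_cases h : j = 0
    · subst h
      rw [if_pos rfl, if_pos rfl, if_neg (Nat.succ_ne_zero _), add_zero, smul_comm, smul_sub,
        hw _ (B.la_pos t)]
      have : Q.opMk q (arr K ((Q.σ ^ B.la t) (B.α t))) • B.Cb q ω (B.τ t) (B.lb (B.τ t)) = 0 :=
        bmod_smul_eq_zero _ (B.lb_pos _) (B.end_ne t).symm
      rw [this, sub_zero, zero_add]
    · rw [if_neg h, if_neg h, if_neg (Nat.succ_ne_zero _), hw _ (by omega), Units.val_one,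
        one_smul, add_assoc]
  · change Q.opMk q (arr K ((Q.σ ^ j) ((Q.σ ^ B.lb s) (B.β s)))) • _ = ((1 : Kˣ) : K) • _
    rw [pow_pow_apply, Units.val_one, one_smul, if_neg (Nat.succ_ne_zero _)]
    have hw : ∀ i, Q.opMk q (arr K ((Q.σ ^ i) (B.β s))) • B.Cb q ω s i =
        ((if i = B.lb s then B.ρ q ω s else 1 : Kˣ) : K) • B.Cb q ω s (i + 1) :=
      fun i => bmod_step (B.cover_admissible q ω) s i
    by_cases h : j = 0
    · subst h
      have hne : (Q.σ ^ B.lb s) (B.β s) ≠ (Q.σ ^ B.la (B.τ.symm s)) (B.α (B.τ.symm s)) := by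
        have := B.end_ne (B.τ.symm s)
        rwa [Equiv.apply_symm_apply] at this
      have : Q.opMk q (arr K ((Q.σ ^ B.lb s) (B.β s))) •
          B.Ca q ω (B.τ.symm s) (B.la (B.τ.symm s)) = 0 :=
        amod_smul_eq_zero _ (B.la_pos _) hne
      -- The sign in the difference cancels against `Ωscalar * ρ = -1`. This is what determines
      -- `Ωscalar`: all weights along `β` become `1`.
      rw [if_pos rfl, add_zero, smul_comm, smul_sub, this, Equiv.apply_symm_apply, hw, if_pos rfl,
        zero_sub, smul_neg, smul_smul, Ωscalar_mul_ρ, neg_smul, one_smul, neg_neg, zero_add]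
    · rw [if_neg h, hw, if_neg (by omega), Units.val_one, one_smul, add_assoc]
  · change Q.opMk q (vert K (Q.src ((Q.σ ^ j) ((Q.σ ^ B.la t) (B.α t))))) • _ = _
    rw [pow_pow_apply]
    by_cases h : j = 0
    · subst h
      have h1 : Q.opMk q (vert K (Q.src ((Q.σ ^ (B.la t)) (B.α t)))) • B.Ca q ω t (B.la t) =
        B.Ca q ω t (B.la t) := amod_vert _ _ _
      have h2 : Q.opMk q (vert K (Q.src ((Q.σ ^ (B.lb (B.τ t))) (B.β (B.τ t))))) •
        B.Cb q ω (B.τ t) (B.lb (B.τ t)) = B.Cb q ω (B.τ t) (B.lb (B.τ t)) := bmod_vert _ _ _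
      rw [B.src_end] at h2
      rw [if_pos rfl, add_zero, smul_comm, smul_sub, h1, h2]
    · rw [if_neg h]
      exact amod_vert _ _ _
  · change Q.opMk q (vert K (Q.src ((Q.σ ^ j) ((Q.σ ^ B.lb s) (B.β s))))) • _ = _
    rw [pow_pow_apply, if_neg h0.ne']
    exact bmod_vert _ _ _
  · rw [if_pos rfl, smul_comm, smul_sub]
    have h3 : Q.opMk q (arr K γ) • B.Ca q ω t (B.la t) = 0 :=
      amod_smul_eq_zero _ (B.la_pos t) h1
    have h4 : Q.opMk q (arr K γ) • B.Cb q ω (B.τ t) (B.lb (B.τ t)) = 0 :=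
      bmod_smul_eq_zero _ (B.lb_pos _) (h2 (B.τ t) (B.τ.symm_apply_apply t))
    rw [h3, h4, sub_zero, smul_zero]
  · rw [if_neg h0.ne']
    refine amod_smul_eq_zero _ (Nat.add_pos_right _ h0) ?_
    rw [← pow_pow_apply]
    exact hγ
  · rw [if_neg h0.ne']
    refine bmod_smul_eq_zero _ (Nat.add_pos_right _ h0) ?_
    rw [← pow_pow_apply]
    exact hγ
  · rw [if_neg (Zigzag.lb_pos _ _).ne']
    change Q.opMk q (arr K γ) • B.Cb q ω s (B.lb s +
      (Q.len ((Q.σ ^ B.lb s) (B.β s)) - B.lb s)) = 0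
    rw [hlb]
    exact bmod_lb_smul (B.cover_admissible q ω) s γ

/-- The projective cover of a band module together with its kernel. -/
lemma exists_shortExact : ∃ (f : B.Cover q ω →ₗ[(Q.Alg q)ᵐᵒᵖ] B.M q ω)
    (g : B.Ω.M q (B.Ωscalar q ω) →ₗ[(Q.Alg q)ᵐᵒᵖ] B.Cover q ω),
    Function.Surjective f ∧ Function.Injective g ∧ Function.Exact g f ∧
      IsSuperfluous (LinearMap.ker f) := by
  obtain ⟨f, hfa, hfb⟩ := (B.aug_isZigzag q ω).exists_hom (B.cover_admissible q ω)
  obtain ⟨g, hga, hgb⟩ :=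
    (B.inc_isZigzag q ω).exists_hom (B.Ω.zigzag_admissible q (B.Ωscalar q ω))
  have hla : ∀ t, B.Ω.la t = Q.len (B.α t) - B.la t := fun t => by
    simp only [Ω, BandWord.len_pow]
  have hlb : ∀ t, B.Ω.lb t = Q.len (B.β t) - B.lb t := fun t => by
    simp only [Ω, BandWord.len_pow]
  replace hfa : ∀ t j, j ≤ Q.len (B.α t) → f (B.Ca q ω t j) = B.Ma q ω t j := hfa
  replace hfb : ∀ s j, j ≤ Q.len (B.β s) → f (B.Cb q ω s j) = B.Mb q ω s j := hfb
  have hg0 : ∀ t, g (B.Ω.Ma q (B.Ωscalar q ω) t 0) = (B.Ωscalar q ω t : K) •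
      (B.Ca q ω t (B.la t) - B.Cb q ω (B.τ t) (B.lb (B.τ t))) := fun t =>
    (hga t 0 (Nat.zero_le _)).trans (if_pos rfl)
  replace hga : ∀ t j, 0 < j → j ≤ B.Ω.la t →
      g (B.Ω.Ma q (B.Ωscalar q ω) t j) = B.Ca q ω t (B.la t + j) := fun t j h0 hj =>
    (hga t j hj).trans (if_neg h0.ne')
  replace hgb : ∀ t j, 0 < j → j ≤ B.Ω.lb t →
      g (B.Ω.Mb q (B.Ωscalar q ω) t j) = B.Cb q ω t (B.lb t + j) := fun t j h0 hj =>
    (hgb t j hj).trans (if_neg h0.ne')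
  have hend : ∀ t, B.Ma q ω t (B.la t) = B.Mb q ω (B.τ t) (B.lb (B.τ t)) := fun t =>
    amod_la (B.zigzag_admissible q ω) t
  -- A linear section of the projection, not equivariant: surjectivity and exactness only need
  -- linear algebra.
  obtain ⟨s, hsa, hsb⟩ := exists_linearMap (B.zigzag_admissible q ω) (B.Ca q ω) (B.Cb q ω)
  replace hsa : ∀ t j, j < B.la t → s (B.Ma q ω t j) = B.Ca q ω t j := hsa
  replace hsb : ∀ t j, 0 < j → j ≤ B.lb t → s (B.Mb q ω t j) = B.Cb q ω t j := hsb
  -- A linear retraction of the inclusion. It reads a new top from the `α`-half of its difference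
  -- alone, the `β`-half being sent to zero.
  obtain ⟨r, hra, hrb⟩ := exists_linearMap (B.cover_admissible q ω)
    (fun t j => if j < B.la t then 0 else if j = B.la t then
      ((B.Ωscalar q ω t : K))⁻¹ • B.Ω.Ma q (B.Ωscalar q ω) t 0 else
      B.Ω.Ma q (B.Ωscalar q ω) t (j - B.la t))
    (fun s j => if j ≤ B.lb s then 0 else B.Ω.Mb q (B.Ωscalar q ω) s (j - B.lb s))
  have hr0 : ∀ t, r (B.Ca q ω t (B.la t)) =
      (B.Ωscalar q ω t : K)⁻¹ • B.Ω.Ma q (B.Ωscalar q ω) t 0 := fun t =>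
    (hra t _ (B.la_lt t)).trans (by rw [if_neg (lt_irrefl _), if_pos rfl])
  -- The inequality is strict because the last point is the shared socle, which is indexed as a
  -- point of a `β`-path.
  replace hra : ∀ t j, 0 < j → j < B.Ω.la t →
      r (B.Ca q ω t (B.la t + j)) = B.Ω.Ma q (B.Ωscalar q ω) t j := fun t j h0 hj =>
    (hra t _ (by rw [hla] at hj; change _ < Q.len (B.α t); omega)).trans
      (by rw [if_neg (by omega), if_neg (by omega), Nat.add_sub_cancel_left])
  have hrb0 : ∀ t, r (B.Cb q ω t (B.lb t)) = 0 := fun t =>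
    (hrb t _ (B.lb_pos t) (B.lb_lt t).le).trans (if_pos le_rfl)
  replace hrb : ∀ t j, 0 < j → j ≤ B.Ω.lb t →
      r (B.Cb q ω t (B.lb t + j)) = B.Ω.Mb q (B.Ωscalar q ω) t j := fun t j h0 hj =>
    (hrb t _ (by omega) (by rw [hlb] at hj; change _ ≤ Q.len (B.β t); omega)).trans
      (by rw [if_neg (by omega), Nat.add_sub_cancel_left])
  have hfs : ∀ x, f (s x) = x := by
    refine induction_points (B.zigzag_admissible q ω) ?_ ?_ ?_ ?_ ?_
    · intro x y hx hy
      rw [map_add, map_add, hx, hy]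
    · rw [map_zero, map_zero]
    · intro c x hx
      rw [map_smul, ← algebraMap_smul (Q.Alg q)ᵐᵒᵖ c (s x), map_smul, hx, algebraMap_smul]
    · intro t j hj
      replace hj : j < B.la t := hj
      exact (congrArg f (hsa t j hj)).trans (hfa t j (hj.le.trans (B.la_lt t).le))
    · intro t j h0 hj
      exact (congrArg f (hsb t j h0 hj)).trans (hfb t j (hj.trans (B.lb_lt t).le))
  have hrg : ∀ x, r (g x) = x := by
    refine induction_points (B.Ω.zigzag_admissible q (B.Ωscalar q ω)) ?_ ?_ ?_ ?_ ?_
    · intro x y hx hy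
      rw [map_add, map_add, hx, hy]
    · rw [map_zero, map_zero]
    · intro c x hx
      rw [← algebraMap_smul (Q.Alg q)ᵐᵒᵖ c x, map_smul, algebraMap_smul, map_smul, hx,
        algebraMap_smul]
    · intro t j hj
      rcases Nat.eq_zero_or_pos j with rfl | h0
      · refine (congrArg r (hg0 t)).trans ?_
        rw [map_smul, map_sub, hr0, hrb0, sub_zero, smul_smul,
          mul_inv_cancel₀ (Units.ne_zero _), one_smul]
      · exact (congrArg r (hga t j h0 hj.le)).trans (hra t j h0 hj)
    · intro t j h0 hj
      exact (congrArg r (hgb t j h0 hj)).trans (hrb t j h0 hj)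
  have hfg : ∀ x, f (g x) = 0 := by
    refine induction_points (B.Ω.zigzag_admissible q (B.Ωscalar q ω)) ?_ ?_ ?_ ?_ ?_
    · intro x y hx hy
      rw [map_add, map_add, hx, hy, add_zero]
    · rw [map_zero, map_zero]
    · intro c x hx
      rw [← algebraMap_smul (Q.Alg q)ᵐᵒᵖ c x, map_smul, map_smul, hx, smul_zero]
    · intro t j hj
      rcases Nat.eq_zero_or_pos j with rfl | h0
      · refine (congrArg f (hg0 t)).trans ?_
        rw [← algebraMap_smul (Q.Alg q)ᵐᵒᵖ, map_smul, map_sub, hfa _ _ (B.la_lt t).le,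
          hfb _ _ (B.lb_lt _).le, hend, sub_self, smul_zero]
      · refine (congrArg f (hga t j h0 hj.le)).trans ?_
        replace hj : j < B.Ω.la t := hj
        rw [hla] at hj
        rw [hfa _ _ (by omega)]
        exact amod_eq_zero _ (Nat.lt_add_of_pos_right h0)
    · intro t j h0 hj
      refine (congrArg f (hgb t j h0 hj)).trans ?_
      replace hj : j ≤ B.Ω.lb t := hj
      rw [hlb] at hj
      have := B.lb_lt t
      rw [hfb _ _ (by omega)]
      exact bmod_eq_zero _ (Nat.lt_add_of_pos_right h0)
  -- On elements of the kernel of `f` the subtracted term vanishes, so the kernel is contained in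
  -- the image of `g`.
  have hsub : ∀ x, x - s (f x) ∈ LinearMap.range g := by
    refine induction_points (B.cover_admissible q ω) ?_ ?_ ?_ ?_ ?_
    · intro x y hx hy
      rw [map_add, map_add, add_sub_add_comm]
      exact Submodule.add_mem _ hx hy
    · rw [map_zero, map_zero, sub_zero]
      exact Submodule.zero_mem _
    · intro c x hx
      rw [← algebraMap_smul (Q.Alg q)ᵐᵒᵖ c x, map_smul, algebraMap_smul, algebraMap_smul, map_smul,
        ← smul_sub]
      exact ((LinearMap.range g).restrictScalars K).smul_mem c hx
    · intro t j hj
      replace hj : j < Q.len (B.α t) := hj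
      change B.Ca q ω t j - s (f (B.Ca q ω t j)) ∈ _
      rw [hfa _ _ hj.le]
      rcases lt_trichotomy j (B.la t) with h | rfl | h
      · rw [hsa _ _ h, sub_self]
        exact Submodule.zero_mem _
      · rw [hend, hsb _ _ (B.lb_pos _) le_rfl]
        have h1 : B.Ca q ω t (B.la t) - B.Cb q ω (B.τ t) (B.lb (B.τ t)) =
            (B.Ωscalar q ω t : K)⁻¹ • g (B.Ω.Ma q (B.Ωscalar q ω) t 0) := by
          rw [hg0, smul_smul, inv_mul_cancel₀ (Units.ne_zero _), one_smul]
        rw [h1]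
        exact ((LinearMap.range g).restrictScalars K).smul_mem _ ⟨_, rfl⟩
      · have h0 : B.Ma q ω t j = 0 := amod_eq_zero _ h
        rw [h0, map_zero, sub_zero]
        refine ⟨B.Ω.Ma q (B.Ωscalar q ω) t (j - B.la t), ?_⟩
        rw [hga _ _ (by omega) (by rw [hla]; omega), Nat.add_sub_cancel' h.le]
    · intro t j h0 hj
      replace hj : j ≤ Q.len (B.β t) := hj
      change B.Cb q ω t j - s (f (B.Cb q ω t j)) ∈ _
      rw [hfb _ _ hj]
      by_cases h : j ≤ B.lb t
      · rw [hsb _ _ h0 h, sub_self]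
        exact Submodule.zero_mem _
      · have h0 : B.Mb q ω t j = 0 := bmod_eq_zero _ (not_le.1 h)
        rw [h0, map_zero, sub_zero]
        refine ⟨B.Ω.Mb q (B.Ωscalar q ω) t (j - B.lb t), ?_⟩
        rw [hgb _ _ (by omega) (by rw [hlb]; omega), Nat.add_sub_cancel' (by omega)]
  refine ⟨f, g, fun x => ⟨s x, hfs x⟩, fun x y hxy => ?_, fun x => ⟨fun hx => ?_, ?_⟩, ?_⟩
  · rw [← hrg x, hxy, hrg]
  · have := hsub x
    rwa [hx, map_zero, sub_zero] at this
  · rintro ⟨x, rfl⟩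
    exact hfg x
  -- The kernel is the image of `g`, which only involves points strictly below the tops because the
  -- paths of the band have positive length.
  · refine isSuperfluous_of_top_eq_zero _ _ fun x hx t => ?_
    have h1 := hsub x
    rw [LinearMap.mem_ker.1 hx, map_zero, sub_zero] at h1
    obtain ⟨y, rfl⟩ := h1
    clear hx
    refine induction_points (B.Ω.zigzag_admissible q (B.Ωscalar q ω))
      (P := fun y => (g y : (B.cover ω (B.ρ q ω)).Pt → K) _ = 0) ?_ ?_ ?_ ?_ ?_ y
    · intro x y hx hy
      rw [map_add]
      exact (congrArg₂ (· + ·) hx hy).trans (add_zero 0)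
    · rw [map_zero]
      rfl
    · intro c x hx
      rw [← algebraMap_smul (Q.Alg q)ᵐᵒᵖ c x, map_smul, algebraMap_smul]
      exact (congrArg (c * ·) hx).trans (mul_zero c)
    · intro t' j hj
      rcases Nat.eq_zero_or_pos j with rfl | h0
      · refine (congrFun (hg0 t') _).trans ?_
        refine (congrArg₂ (fun x y : K => _ * (x - y)) (amod_apply_top _ (B.la_pos t') t)
          (bmod_apply_top _ (B.lb_pos _) t)).trans ?_
        rw [sub_zero, mul_zero]
      · exact (congrFun (hga t' j h0 hj.le) _).trans (amod_apply_top _ (by omega) t)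
    · intro t' j h0 hj
      exact (congrFun (hgb t' j h0 hj) _).trans (bmod_apply_top _ (by omega) t)

end Band
end SpecialBiserial

lemma IsSuperfluous.ker_comp_equiv {R : Type w} [Ring R] {P : Type x} {P' : Type y} {N : Type*}
    [AddCommGroup P] [Module R P] [AddCommGroup P'] [Module R P'] [AddCommGroup N] [Module R N]
    {f : P →ₗ[R] N} (hf : IsSuperfluous (LinearMap.ker f)) (e : P' ≃ₗ[R] P) :
    IsSuperfluous (LinearMap.ker (f ∘ₗ e.toLinearMap)) := by
  intro S hS
  have h := hf (S.map e.toLinearMap) (eq_top_iff.2 fun x _ => by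
    have hx : e.symm x ∈ LinearMap.ker (f ∘ₗ e.toLinearMap) ⊔ S := hS ▸ Submodule.mem_top
    obtain ⟨a, ha, s, hs, has⟩ := Submodule.mem_sup.1 hx
    rw [← e.apply_symm_apply x, ← has, map_add]
    exact Submodule.add_mem_sup ha ⟨s, hs, rfl⟩)
  refine eq_top_iff.2 fun x _ => ?_
  have hx : e x ∈ S.map e.toLinearMap := h ▸ Submodule.mem_top
  obtain ⟨s, hs, he⟩ := hx
  rwa [← e.injective he]

/-! ### Isomorphism invariants: the vertices of tops and the product of scalars -/

namespace SpecialBiserial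

variable {V A : Type v} [Fintype V] [Fintype A] {Q : SpecialBiserial V A} {K : Type u} [Field K]

namespace Zigzag

variable {ι : Type} [Fintype ι] [DecidableEq ι] {Z Z' : Zigzag Q K ι} {q : A → Kˣ}
variable (h : Z.Admissible q) (h' : Z'.Admissible q)

open Matrix

/-- The point at which the paths of `α t` and of the corresponding `β s` start. -/
def topPt (Z : Zigzag Q K ι) (t : ι) : Z.Pt := Sum.inl ⟨t, ⟨0, Z.la_pos t⟩⟩

/-- The point at which the path of `β s` ends. -/
def soclePt (Z : Zigzag Q K ι) (s : ι) : Z.Pt :=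
  Sum.inr ⟨s, ⟨Z.lb s - 1, Nat.sub_lt (Z.lb_pos _) one_pos⟩⟩

lemma amod_zero_eq (t : ι) : amod h t 0 = basis h (Z.topPt t) :=
  (basis_inl h ⟨t, ⟨0, Z.la_pos t⟩⟩).symm

/-- An isomorphism maps each top to an element involving a top at the same vertex. -/
lemma exists_top (φ : Mod h ≃ₗ[(Q.Alg q)ᵐᵒᵖ] Mod h') (t : ι) :
    ∃ t', Q.src (Z'.α t') = Q.src (Z.α t) ∧
      (φ (amod h t 0) : Z'.Pt → K) (Z'.topPt t') ≠ 0 := by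
  classical
  by_contra hn
  push Not at hn
  set y := φ (amod h t 0) with hy
  have hvert : Q.opMk q (vert K (Q.src (Z.α t))) • y = y := by
    rw [hy, ← map_smul]
    exact congrArg φ (amod_vert h t 0)
  have htop : ∀ t', (y : Z'.Pt → K) (Z'.topPt t') = 0 := by
    intro t'
    by_cases hs : Q.src (Z'.α t') = Q.src (Z.α t)
    · exact hn t' hs
    · rw [← hvert, opMk_vert_smul_eq]
      exact (Z'.vecMul_vert_apply _ _ _).trans (if_neg hs)
  -- If `y` had no top coordinate it would lie in the radical. Its preimage would then too, since
  -- basis vectors below the tops are images under arrows and no step ends at a top.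
  have hcoord : ∀ p, (y : Z'.Pt → K) p * (φ.symm (basis h' p) : Z.Pt → K) (Z.topPt t) = 0 := by
    intro p
    by_cases hp : ∃ t', p = Z'.topPt t'
    · obtain ⟨t', rfl⟩ := hp
      rw [htop, zero_mul]
    · push Not at hp
      obtain ⟨s, rfl⟩ := Z'.exists_finish_eq p hp
      have h0 : (Q.opMk q (arr K (Z'.label s)) • φ.symm (basis h' (Z'.start s)) : Z.Pt → K)
          (Z.topPt t) = 0 := by
        rw [opMk_arr_smul_eq]
        exact Z.vecMul_eq_zero_of_finish_ne _ _ _ fun s => Z.finish_ne_top s t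
      rw [basis_finish, ← algebraMap_smul (Q.Alg q)ᵐᵒᵖ ((Z'.weight s)⁻¹), map_smul, map_smul,
        algebraMap_smul]
      exact (congrArg _ ((congrArg _ h0).trans (mul_zero _))).trans (mul_zero _)
  have hsum : (φ.symm y : Z.Pt → K) (Z.topPt t) = 0 := by
    have h1 : φ.symm y = ∑ p, (y : Z'.Pt → K) p • φ.symm (basis h' p) := by
      conv_lhs => rw [← (basis h').sum_repr y, map_sum]
      refine Finset.sum_congr rfl fun p _ => ?_
      rw [← algebraMap_smul (Q.Alg q)ᵐᵒᵖ, map_smul, algebraMap_smul]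
      rfl
    rw [h1]
    refine (Finset.sum_apply (M := fun _ => K) _ _ _).trans ?_
    exact Finset.sum_eq_zero fun p _ => hcoord p
  rw [hy, LinearEquiv.symm_apply_apply, amod_zero_eq, basis_apply, Pi.single_eq_same] at hsum
  exact one_ne_zero hsum

/-- Only one step with a given label ends at a given point, so tracing the path backwards from its
end isolates a single top coordinate, even when `x` is a general vector. -/
lemma run_apply_inl (x : Z.Pt → K) (t : ι) (j : ℕ) (hj : j < Z.la t) :
    (x ᵥ* FreeAlgebra.lift K Z.mat (Q.run K (Z.α t) (j + 1)))
      (Z.finish (Sum.inl ⟨t, ⟨j, hj⟩⟩)) =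
      (∏ i ∈ Finset.range (j + 1), (Z.wa t i : K)) * x (Z.topPt t) := by
  induction j with
  | zero =>
    rw [run_succ, map_mul, ← vecMul_vecMul, arr, FreeAlgebra.lift_ι_apply]
    refine (Z.vecMul_finish _ (Sum.inl ⟨t, ⟨0, hj⟩⟩)).trans ?_
    rw [run_zero, map_one, vecMul_one]
    simp [weight, start, topPt]
  | succ n ih =>
    have hf : Z.finish (Sum.inl ⟨t, ⟨n, by omega⟩⟩) = Sum.inl ⟨t, ⟨n + 1, hj⟩⟩ := dif_pos hj
    have := ih (by omega)
    rw [hf] at this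
    rw [run_succ, map_mul, ← vecMul_vecMul, arr, FreeAlgebra.lift_ι_apply]
    refine (Z.vecMul_finish _ (Sum.inl ⟨t, ⟨n + 1, hj⟩⟩)).trans ?_
    refine (congrArg _ this).trans ?_
    rw [Finset.prod_range_succ _ (n + 1)]
    simp only [weight]
    ring

lemma run_apply_inr (x : Z.Pt → K) (s : ι) (j : ℕ) (hj : j < Z.lb s) :
    (x ᵥ* FreeAlgebra.lift K Z.mat (Q.run K (Z.β s) (j + 1))) (Sum.inr ⟨s, ⟨j, hj⟩⟩) =
      (∏ i ∈ Finset.range (j + 1), (Z.wb s i : K)) * x (Z.topPt (Z.nx s)) := by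
  induction j with
  | zero =>
    rw [run_succ, map_mul, ← vecMul_vecMul, arr, FreeAlgebra.lift_ι_apply]
    refine (Z.vecMul_finish _ (Sum.inr ⟨s, ⟨0, hj⟩⟩)).trans ?_
    rw [run_zero, map_one, vecMul_one]
    simp [weight, start, topPt]
  | succ n ih =>
    rw [run_succ, map_mul, ← vecMul_vecMul, arr, FreeAlgebra.lift_ι_apply]
    refine (Z.vecMul_finish _ (Sum.inr ⟨s, ⟨n + 1, hj⟩⟩)).trans ?_
    refine (congrArg _ (ih (by omega))).trans ?_
    rw [Finset.prod_range_succ _ (n + 1)]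
    simp only [weight]
    ring

lemma run_apply_soclePt_α (x : Mod h) (t : ι) :
    (Q.opMk q (Q.run K (Z.α t) (Z.la t)) • x : Z.Pt → K) (Z.soclePt (Z.τ t)) =
      (∏ i ∈ Finset.range (Z.la t), (Z.wa t i : K)) * (x : Z.Pt → K) (Z.topPt t) := by
  have hla := Z.la_pos t
  have hf : Z.finish (Sum.inl ⟨t, ⟨Z.la t - 1, by omega⟩⟩) = Z.soclePt (Z.τ t) :=
    dif_neg (by simp only; omega)
  have := run_apply_inl (x : Z.Pt → K) t (Z.la t - 1) (by omega)
  rw [hf, Nat.sub_add_cancel hla] at this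
  rw [opMk_smul_eq]
  exact this

lemma run_apply_soclePt_β (x : Mod h) (s : ι) :
    (Q.opMk q (Q.run K (Z.β s) (Z.lb s)) • x : Z.Pt → K) (Z.soclePt s) =
      (∏ i ∈ Finset.range (Z.lb s), (Z.wb s i : K)) * (x : Z.Pt → K) (Z.topPt (Z.nx s)) := by
  have hlb := Z.lb_pos s
  have := run_apply_inr (x : Z.Pt → K) s (Z.lb s - 1) (by omega)
  rw [Nat.sub_add_cancel hlb] at this
  rw [opMk_smul_eq]
  exact this

end Zigzag

namespace Band

open Zigzag

variable {ι : Type} [Fintype ι] [DecidableEq ι] (B : Band Q ι) (q : A → Kˣ) (ω : ι → Kˣ)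

/-- The product of the scalars is an invariant of a band module. -/
lemma prod_eq_of_equiv (hB : Function.Injective fun t => Q.src (B.α t)) {ω ω' : ι → Kˣ}
    (φ : B.M q ω ≃ₗ[(Q.Alg q)ᵐᵒᵖ] B.M q ω') : ∏ t, ω t = ∏ t, ω' t := by
  set h := B.zigzag_admissible q ω
  set h' := B.zigzag_admissible q ω'
  let c : ι → K := fun t => (φ (amod h t 0) : (B.zigzag ω').Pt → K) ((B.zigzag ω').topPt t)
  let d : ι → K := fun s =>
    (φ (bmod h s (B.lb s)) : (B.zigzag ω').Pt → K) ((B.zigzag ω').soclePt s)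
  -- Injectivity of the top vertices enters here: the only top at the vertex of `t` is that of `t`
  -- itself.
  have hc : ∀ t, c t ≠ 0 := by
    intro t
    obtain ⟨t', ht, hne⟩ := exists_top h h' φ t
    obtain rfl : t' = t := hB ht
    exact hne
  have hprod : ∀ (ω : ι → Kˣ) t, ∏ i ∈ Finset.range (B.la t), (((B.zigzag ω).wa t i : Kˣ) : K) =
      ω t := by
    intro ω t
    change ∏ i ∈ Finset.range (B.la t), ((if i = 0 then ω t else 1 : Kˣ) : K) = ω t
    rw [← Units.coe_prod, Finset.prod_ite_eq', if_pos (Finset.mem_range.2 (B.la_pos t))]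
  have hprod' : ∀ (ω : ι → Kˣ) t,
      ∏ i ∈ Finset.range (B.lb t), (((B.zigzag ω).wb t i : Kˣ) : K) = 1 :=
    fun ω t => Finset.prod_eq_one fun _ _ => rfl
  -- The path of `α t` is applied to `φ` of the top in two ways: before `φ`, where it yields `ω t`
  -- times a socle element, and after, where it picks out a top coordinate.
  have h1 : ∀ t, (ω t : K) * d (B.τ t) = ω' t * c t := by
    intro t
    have e1 : Q.opMk q (Q.run K (B.α t) (B.la t)) • φ (amod h t 0) =
        (ω t : K) • φ (bmod h (B.τ t) (B.lb (B.τ t))) := by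
      rw [← map_smul]
      refine (congrArg φ (amod_run h t (B.la t))).trans ?_
      rw [hprod, ← algebraMap_smul (Q.Alg q)ᵐᵒᵖ, map_smul, algebraMap_smul]
      exact congrArg (fun z => (ω t : K) • φ z) (amod_la h t)
    have e2 := run_apply_soclePt_α h' (φ (amod h t 0)) t
    refine Eq.trans ?_ (e2.trans (congrArg (· * _) (hprod ω' t)))
    exact (congrFun e1 ((B.zigzag ω').soclePt (B.τ t))).symm
  have h2 : ∀ s, d s = c (B.nx s) := by
    intro s
    have e1 : Q.opMk q (Q.run K (B.β s) (B.lb s)) • φ (amod h (B.nx s) 0) =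
        φ (bmod h s (B.lb s)) := by
      rw [← map_smul]
      have h0 : amod h (B.nx s) 0 = bmod h s 0 := (bmod_zero h s).symm
      rw [h0]
      refine (congrArg φ (bmod_run h s (B.lb s))).trans ?_
      rw [hprod', one_smul]
    have e2 := run_apply_soclePt_β h' (φ (amod h (B.nx s) 0)) s
    refine Eq.trans ?_ (e2.trans ((congrArg (· * _) (hprod' ω' s)).trans (one_mul _)))
    exact (congrFun e1 ((B.zigzag ω').soclePt s)).symm
  -- Going once around the permutations `τ` and `nx` turns the product of the `d` into that of the
  -- `c`, so the unknown coordinates cancel.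
  have h3 : (∏ t, (ω t : K)) * ∏ t, c t = (∏ t, (ω' t : K)) * ∏ t, c t := by
    have e1 : ∏ t, d (B.τ t) = ∏ t, c t := by
      rw [Equiv.prod_comp B.τ d, Finset.prod_congr rfl fun s _ => h2 s, Equiv.prod_comp B.nx c]
    rw [← e1, ← Finset.prod_mul_distrib, e1, ← Finset.prod_mul_distrib]
    exact Finset.prod_congr rfl fun t _ => h1 t
  have h4 := mul_right_cancel₀ (Finset.prod_ne_zero_iff.2 fun t _ => hc t) h3
  exact Units.ext (by rw [Units.coe_prod, Units.coe_prod, h4])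

/-! ### Iterated syzygies and the resolution -/

/-- The data of the syzygies of a band module. -/
def iter : ℕ → Band Q ι × (ι → Kˣ)
  | 0 => (B, ω)
  | n + 1 => ((iter n).1.Ω, (iter n).1.Ωscalar q (iter n).2)

lemma iter_succ (n : ℕ) : B.iter q ω (n + 1) =
    ((B.iter q ω n).1.Ω, (B.iter q ω n).1.Ωscalar q (B.iter q ω n).2) := rfl

lemma prod_Ωscalar : ∏ t, B.Ωscalar q ω t =
    (∏ t, q (B.β t)) / ((∏ t, q (B.α t)) * ∏ t, ω t) := by
  have h1 : ∀ t, B.Ωscalar q ω t =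
      q (B.β (B.τ t)) / (q (B.α (B.nx (B.τ t))) * ω (B.nx (B.τ t))) := by
    intro t
    rw [Ωscalar, ρ, inv_neg, neg_neg, inv_div]
  rw [Finset.prod_congr rfl fun t _ => h1 t,
    Equiv.prod_comp B.τ fun t => q (B.β t) / (q (B.α (B.nx t)) * ω (B.nx t)),
    Finset.prod_div_distrib, Equiv.prod_comp B.nx fun t => q (B.α t) * ω t,
    Finset.prod_mul_distrib]

/-- The factor by which the second syzygy changes the product of the scalars. -/
def param : Kˣ := (∏ t, q (B.Ω.β t) / q (B.Ω.α t)) * ∏ t, q (B.α t) / q (B.β t)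

/-- One syzygy inverts the product of the scalars up to a factor built from `q`. Two inversions
cancel, and the factors of the two shapes combine to `param`. -/
lemma iter_even (k : ℕ) : (B.iter q ω (2 * k)).1 = B ∧
    ∏ t, (B.iter q ω (2 * k)).2 t = (∏ t, ω t) * B.param q ^ k := by
  induction k with
  | zero => simp [iter]
  | succ k ih =>
    rw [Nat.mul_succ, iter_succ, iter_succ]
    obtain ⟨h1, h2⟩ := ih
    refine ⟨by simp only [h1, Ω_Ω], ?_⟩
    simp only [prod_Ωscalar, h1, h2, param, Finset.prod_div_distrib, pow_succ]
    rw [div_eq_iff_eq_mul]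
    simp only [div_eq_mul_inv, mul_inv_rev]
    generalize (∏ t, q (B.Ω.β t)) = x1
    generalize (∏ t, q (B.Ω.α t)) = x2
    generalize (∏ t, q (B.α t)) = x3
    generalize (∏ t, q (B.β t)) = x4
    generalize (∏ t, ω t) = x5
    generalize (x1 * x2⁻¹ * (x3 * x4⁻¹)) ^ k = x6
    rw [← Units.val_inj]
    push_cast
    field_simp

lemma card_cover_pt (ρ : ι → Kˣ) :
    Fintype.card (B.cover ω ρ).Pt = ∑ t, Q.len (B.α t) + ∑ t, Q.len (B.β t) := by
  rw [Fintype.card_sum, Fintype.card_sigma, Fintype.card_sigma]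
  simp only [Fintype.card_fin]
  rfl

lemma sum_len_iter (n : ℕ) : ∑ t, Q.len ((B.iter q ω n).1.α t) + ∑ t, Q.len ((B.iter q ω n).1.β t) =
    ∑ t, Q.len (B.α t) + ∑ t, Q.len (B.β t) := by
  induction n with
  | zero => rfl
  | succ n ih =>
    rw [iter_succ, ← ih]
    simp only [Ω, BandWord.len_pow]

/-- The projective covers of the iterated syzygies of a band module. -/
def coverSequence : CoverSequence.{max u v, u, max u v} (Q.Alg q)ᵐᵒᵖ
    (fun n => (B.iter q ω n).1.M q (B.iter q ω n).2) :=
  have hex := fun n => (B.iter q ω n).1.exists_shortExact q (B.iter q ω n).2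
  -- The lift puts the projectives into the universe of the algebra, as
  -- `MinimalProjectiveResolution` demands.
  { P := fun n => ULift.{v} ((B.iter q ω n).1.Cover q (B.iter q ω n).2)
    aug := fun n => (hex n).choose ∘ₗ ULift.moduleEquiv.toLinearMap
    inc := fun n => ULift.moduleEquiv.symm.toLinearMap ∘ₗ (hex n).choose_spec.choose
    projective := fun n => Module.Projective.of_equiv ULift.moduleEquiv.symm
    surjective_aug := fun n =>
      (hex n).choose_spec.choose_spec.1.comp ULift.moduleEquiv.surjective
    injective_inc := fun n =>
      ULift.moduleEquiv.symm.injective.comp (hex n).choose_spec.choose_spec.2.1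
    exact_inc_aug := fun n => by
      have h := (hex n).choose_spec.choose_spec.2.2.1
      intro x
      refine (h (ULift.moduleEquiv x)).trans ⟨?_, ?_⟩
      · rintro ⟨y, hy⟩
        exact ⟨y, ULift.moduleEquiv.injective hy⟩
      · rintro ⟨y, rfl⟩
        exact ⟨y, rfl⟩
    minimal := fun n =>
      (hex n).choose_spec.choose_spec.2.2.2.ker_comp_equiv ULift.moduleEquiv }

end Band
end SpecialBiserial

/-- Restriction of scalars along `K → R` recovers a given compatible `K`-module structure. -/
def restrictScalarsEquiv (K : Type u) [Field K] (R : Type w) [Ring R] [Algebra K R] (M : Type x)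
    [AddCommGroup M] [Module R M] [Module K M] [IsScalarTower K R M] :
    M ≃ₗ[K] RestrictScalars K R M :=
  { (RestrictScalars.addEquiv K R M).symm with
    map_smul' := fun c x => by
      rw [← algebraMap_smul R c x]
      rfl }

namespace SpecialBiserial

variable {V A : Type v} [Fintype V] [Fintype A] {Q : SpecialBiserial V A} {K : Type u} [Field K]

namespace Band

open Zigzag

variable {ι : Type} [Fintype ι] [DecidableEq ι] (B : Band Q ι) (q : A → Kˣ) (ω : ι → Kˣ)

lemma rank_coverSequence_le (n : ℕ) :
    Module.rank K (RestrictScalars K (Q.Alg q)ᵐᵒᵖ ((B.coverSequence q ω).P n)) ≤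
      ((∑ t, Q.len (B.α t) + ∑ t, Q.len (B.β t) : ℕ) : Cardinal) := by
  let b := ((basis ((B.iter q ω n).1.cover_admissible q (B.iter q ω n).2)).map
    (ULift.moduleEquiv.{u, u, v} (R := K)).symm).map
    (restrictScalarsEquiv K (Q.Alg q)ᵐᵒᵖ (ULift.{v} ((B.iter q ω n).1.Cover q (B.iter q ω n).2)))
  refine (rank_eq_card_basis b).trans_le ?_
  rw [card_cover_pt, sum_len_iter]

/-- Even syzygies are told apart by the product of scalars, odd ones by a top vertex of `B` that is
not a top vertex of `B.Ω`. -/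
lemma not_nonempty_equiv_iter (hB : Function.Injective fun t => Q.src (B.α t))
    {t₀ : ι} (ht₀ : ∀ t, Q.src (B.Ω.α t) ≠ Q.src (B.α t₀)) (hv : ¬ IsOfFinOrder (B.param q))
    (n : ℕ) (hn : 0 < n) :
    ¬ Nonempty ((B.iter q ω n).1.M q (B.iter q ω n).2 ≃ₗ[(Q.Alg q)ᵐᵒᵖ] B.M q ω) := by
  rintro ⟨φ⟩
  obtain ⟨k, rfl | rfl⟩ := n.even_or_odd'
  · obtain ⟨h1, h2⟩ := B.iter_even q ω k
    -- The shape of an even syzygy equals `B` only propositionally; generalizing allows substitution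
    -- in the type of `φ`.
    revert φ h1 h2
    generalize B.iter q ω (2 * k) = p
    obtain ⟨B', ω'⟩ := p
    rintro φ h1 h2
    obtain rfl : B' = B := h1
    have h3 := B'.prod_eq_of_equiv q hB φ
    simp only at h2
    rw [h2, mul_eq_left] at h3
    exact hv (isOfFinOrder_iff_pow_eq_one.2 ⟨k, by omega, h3⟩)
  · obtain ⟨h1, -⟩ := B.iter_even q ω k
    obtain ⟨t', ht', -⟩ := exists_top _ _ φ.symm t₀
    refine ht₀ t' (Eq.trans ?_ ht')
    change _ = Q.src ((B.iter q ω (2 * k)).1.Ω.α t')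
    rw [h1]

end Band

/-! ### Band words as bands, and the choice of the socle parameters -/

namespace BandWord

variable (W : Q.BandWord)

/-- The shape of a band word. -/
def band : Band Q (Fin (W.m + 1)) where
  α t := (W.a t).head
  β t := (W.b t).head
  la t := (W.a t).length
  lb t := (W.b t).length
  la_pos t := (W.a t).length_pos
  lb_pos t := (W.b t).length_pos
  la_lt t := (W.a t).length_lt
  lb_lt t := (W.b t).length_lt
  nx := Equiv.addRight 1
  τ := Equiv.refl _
  src_head := W.source_b
  head_ne := W.head_ne
  src_end t := by
    have := W.target_b t
    have h1 := (W.a t).length_pos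
    have h2 := (W.b t).length_pos
    simp only [InitialPath.target, InitialPath.last, InitialPath.arrow] at this
    rwa [← src_pow_succ, ← src_pow_succ, Nat.sub_add_cancel h1, Nat.sub_add_cancel h2] at this
  end_ne t := by
    have := W.last_ne t
    have h1 := (W.a t).length_pos
    have h2 := (W.b t).length_pos
    simp only [InitialPath.last, InitialPath.arrow] at this
    rwa [← Q.σ.injective.ne_iff, ← pow_succ_apply, ← pow_succ_apply, Nat.sub_add_cancel h1,
      Nat.sub_add_cancel h2] at this

lemma band_Ω_α (t : Fin (W.m + 1)) : W.band.Ω.α t = Q.σ (W.a t).last := by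
  change (Q.σ ^ (W.a t).length) (W.a t).head = _
  rw [InitialPath.last, InitialPath.arrow, ← pow_succ_apply, Nat.sub_add_cancel (W.a t).length_pos]

lemma band_Ω_β (t : Fin (W.m + 1)) : W.band.Ω.β t = Q.σ (W.b t).last := by
  change (Q.σ ^ (W.b t).length) (W.b t).head = _
  rw [InitialPath.last, InitialPath.arrow, ← pow_succ_apply, Nat.sub_add_cancel (W.b t).length_pos]

lemma src_band_Ω_α (t : Fin (W.m + 1)) : Q.src (W.band.Ω.α t) = W.f t := by
  rw [band_Ω_α, Q.src_σ]
  rfl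

/-- The complements start with `σ` of the last arrows, which gives the coefficients at `f t`. At `e
t` the two products differ by the shift `t - 1` of the index. -/
lemma band_param (q : A → Kˣ) : W.band.param q = W.parameter q := by
  rw [Band.param, parameter]
  simp only [band_Ω_α, band_Ω_β]
  congr 1
  rw [Finset.prod_div_distrib, Finset.prod_div_distrib]
  congr 1
  exact (Equiv.prod_comp (Equiv.subRight 1) fun t => q (W.b t).head).symm

/-- The zigzag of a band word. -/
abbrev zigzag (lam : Kˣ) : Zigzag Q K (Fin (W.m + 1)) :=
  W.band.zigzag fun t => if t = 0 then lam else 1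

lemma weight_eq (lam : Kˣ) (s : W.Pt) : W.weight (lam : K) s = (W.zigzag lam).weight s := by
  rcases s with ⟨t, j⟩ | ⟨t, j⟩
  · change (if t = 0 ∧ (j : ℕ) = 0 then (lam : K) else 1) =
      ((if (j : ℕ) = 0 then if t = 0 then lam else 1 else 1 : Kˣ) : K)
    by_cases h1 : t = 0 <;> by_cases h2 : (j : ℕ) = 0 <;> simp [h1, h2]
  · rfl

lemma start_eq (lam : Kˣ) (s : W.Pt) : W.start s = (W.zigzag lam).start s := by
  rcases s with ⟨t, j⟩ | ⟨t, j⟩ <;> rfl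

lemma finish_eq (lam : Kˣ) (s : W.Pt) : W.finish s = (W.zigzag lam).finish s := by
  rcases s with ⟨t, j⟩ | ⟨t, j⟩ <;> rfl

lemma genMatrix_eq (lam : Kˣ) : W.genMatrix (lam : K) = (W.zigzag lam).mat := by
  classical
  funext g
  rcases g with i | α
  · refine congrArg Matrix.diagonal (funext fun z => ?_)
    have : W.vertex z = (W.zigzag lam).vertex z := by
      rcases z with ⟨t, j⟩ | ⟨t, j⟩ <;> rfl
    rw [this]
  · ext y z
    refine Finset.sum_congr rfl fun s _ => ?_
    have h1 : W.label s = (W.zigzag lam).label s := by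
      rcases s with ⟨t, j⟩ | ⟨t, j⟩ <;> rfl
    rw [h1, W.start_eq lam, W.finish_eq lam, W.weight_eq lam]
    rfl

lemma rep_apply (q : A → Kˣ) (lam : Kˣ) (r : Q.Alg q) :
    W.rep q lam r = Zigzag.rep (W.band.zigzag_admissible q fun t => if t = 0 then lam else 1) r := by
  obtain ⟨z, rfl⟩ := RingQuot.mkAlgHom_surjective K (Q.Rel q) r
  have h1 : W.rep q lam (RingQuot.mkAlgHom K (Q.Rel q) z) =
      FreeAlgebra.lift K (W.genMatrix (lam : K)) z :=
    RingQuot.liftAlgHom_mkAlgHom_apply K (FreeAlgebra.lift K (W.genMatrix (lam : K)))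
      (W.lift_rel (lam : K) q) z
  have h2 : Zigzag.rep (W.band.zigzag_admissible q fun t => if t = 0 then lam else 1)
      (RingQuot.mkAlgHom K (Q.Rel q) z) = FreeAlgebra.lift K (W.zigzag lam).mat z :=
    RingQuot.liftAlgHom_mkAlgHom_apply K (FreeAlgebra.lift K (W.zigzag lam).mat)
      (W.band.zigzag_admissible q fun t => if t = 0 then lam else 1).lift_rel z
  exact h1.trans ((congrArg (fun M : V ⊕ A → Matrix (W.zigzag lam).Pt (W.zigzag lam).Pt K =>
    FreeAlgebra.lift K M z) (W.genMatrix_eq lam)).trans h2.symm)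

/-- The band module of a band word is the module of its zigzag. -/
def bandModuleEquiv (q : A → Kˣ) (lam : Kˣ) :
    W.BandModule q lam ≃ₗ[(Q.Alg q)ᵐᵒᵖ] W.band.M q fun t => if t = 0 then lam else 1 where
  toFun x := x
  invFun x := x
  left_inv _ := rfl
  right_inv _ := rfl
  map_add' _ _ := rfl
  map_smul' r x := congrArg (Matrix.vecMul (x : W.Pt → K)) (W.rep_apply q lam r.unop)

/-- The head of `a t₀` starts at a vertex outside the `f t`, so it contributes no coefficient there.
Among the `e t` it occurs exactly once, in the numerator, because these vertices are distinct and
the two heads at each differ. -/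
lemma exists_parameter (x : Kˣ) (he : Function.Injective W.e) {t₀ : Fin (W.m + 1)}
    (ht₀ : ∀ t, W.f t ≠ W.e t₀) : ∃ q : A → Kˣ, W.parameter q = x := by
  classical
  refine ⟨Function.update 1 (W.a t₀).head x, ?_⟩
  have h1 : ∀ t, W.qF (Function.update 1 (W.a t₀).head x) t = 1 := fun t => by
    rw [qF, Function.update_of_ne, Pi.one_apply]
    intro h
    refine ht₀ t ((W.target_b t).symm.trans ?_)
    rw [InitialPath.target, ← Q.src_σ, h]
    rfl
  have h2 : ∀ t, W.pF (Function.update 1 (W.a t₀).head x) t = 1 := fun t => by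
    rw [pF, Function.update_of_ne, Pi.one_apply]
    intro h
    refine ht₀ t ?_
    rw [f, InitialPath.target, ← Q.src_σ, h]
    rfl
  have h3 : ∀ t, W.qE (Function.update 1 (W.a t₀).head x) t = 1 := fun t => by
    rw [qE, Function.update_of_ne, Pi.one_apply]
    intro h
    have hs := W.source_b (t - 1)
    have hn := W.head_ne (t - 1)
    rw [sub_add_cancel] at hs hn
    have : W.e t = W.e t₀ := by
      rw [e, ← hs, InitialPath.source, h]
      rfl
    rw [he this] at hn
    exact hn (he this ▸ h)
  have h4 : ∀ t, W.pE (Function.update 1 (W.a t₀).head x) t = if t = t₀ then x else 1 := fun t => by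
    rw [pE]
    by_cases h : t = t₀
    · rw [h, Function.update_self, if_pos rfl]
    · rw [Function.update_of_ne, if_neg h, Pi.one_apply]
      exact fun h' => h (he (congrArg Q.src h'))
  simp only [parameter, h1, h2, h3, h4, div_one, Finset.prod_const_one, one_mul]
  rw [Finset.prod_ite_eq', if_pos (Finset.mem_univ _)]

lemma isCriminal (q : A → Kˣ) (lam : Kˣ) (he : Function.Injective W.e) {t₀ : Fin (W.m + 1)}
    (ht₀ : ∀ t, W.f t ≠ W.e t₀) (hv : ¬ IsOfFinOrder (W.parameter q)) :
    IsCriminal K (Q.Alg q)ᵐᵒᵖ (W.BandModule q lam) := by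
  let ω : Fin (W.m + 1) → Kˣ := fun t => if t = 0 then lam else 1
  let C := W.band.coverSequence q ω
  let ψ : W.BandModule q lam ≃ₗ[(Q.Alg q)ᵐᵒᵖ] W.band.M q ω := W.bandModuleEquiv q lam
  refine ⟨?_, ⟨?_, ?_⟩, ?_⟩
  · have hfin : Module.Finite K (W.band.M q ω) :=
      Module.Finite.of_basis (Zigzag.basis (W.band.zigzag_admissible q ω))
    have := Module.Finite.equiv (restrictScalarsEquiv K (Q.Alg q)ᵐᵒᵖ (W.band.M q ω))
    let f : RestrictScalars K (Q.Alg q)ᵐᵒᵖ (W.band.M q ω) →ₗ[K]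
        RestrictScalars K (Q.Alg q)ᵐᵒᵖ (W.BandModule q lam) :=
      { toFun := fun x => ψ.symm x
        map_add' := fun x y => ψ.symm.map_add x y
        map_smul' := fun c x => ψ.symm.map_smul (algebraMap K (Q.Alg q)ᵐᵒᵖ c) x }
    exact Module.Finite.of_surjective f ψ.symm.surjective
  · have : Nontrivial ((W.band.iter q ω 1).1.M q (W.band.iter q ω 1).2) :=
      ⟨_, 0, (Zigzag.basis ((W.band.iter q ω 1).1.zigzag_admissible q
        (W.band.iter q ω 1).2)).ne_zero (Zigzag.topPt _ 0)⟩
    exact fun h => C.not_projective (Module.Projective.of_equiv ψ)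
  · exact ⟨C.resolution ψ, _, W.band.rank_coverSequence_le q ω⟩
  · rintro ⟨Y, n, ⟨φ⟩⟩
    obtain ⟨χ⟩ := C.nonempty_syzygy_equiv ψ Y n
    -- The index is shifted because `syzygy n` is the syzygy of order `n + 1`.
    refine W.band.not_nonempty_equiv_iter q ω he (t₀ := t₀) (fun t => ?_) ?_ (n + 1) n.succ_pos
      ⟨χ.symm.trans (φ.trans ψ)⟩
    · rw [src_band_Ω_α]
      exact ht₀ t
    · rwa [band_param]

end BandWord
end SpecialBiserial

end

theorem lemma4p4 {K : Type u} [Field K] [IsAlgClosed K] (hK : ∃ x : Kˣ, ¬ IsOfFinOrder x)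
    {V A : Type v} [Fintype V] [Fintype A] (Q : SpecialBiserial V A) (W : Q.BandWord)
    (he : Function.Injective W.e) (hf : Function.Injective W.f)
    (hef : Set.range W.e ≠ Set.range W.f) :
    ∃ q : A → Kˣ, ¬ IsOfFinOrder (W.parameter q) ∧
      ∀ lam : Kˣ, IsCriminal K (Q.Alg q)ᵐᵒᵖ (W.BandModule q lam) := by
  obtain ⟨x, hx⟩ := hK
  -- Both vertex sets have `m + 1` elements, so an inclusion of the first in the second would be an
  -- equality.
  obtain ⟨t₀, ht₀⟩ : ∃ t₀, ∀ t, W.f t ≠ W.e t₀ := by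
    by_contra hn
    push Not at hn
    have hsub : Set.range W.e ⊆ Set.range W.f := by
      rintro _ ⟨t, rfl⟩
      exact hn t
    refine hef (Set.eq_of_subset_of_ncard_le hsub ?_ (Set.finite_range _))
    rw [← Set.image_univ, ← Set.image_univ, Set.ncard_image_of_injective _ he,
      Set.ncard_image_of_injective _ hf]
  obtain ⟨q, hq⟩ := W.exists_parameter x he ht₀
  rw [← hq] at hx
  exact ⟨q, hx, fun lam => W.isCriminal q lam he ht₀ hx⟩
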